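/- **Setting.** Fix infinite sets $\mathcal V$ of individual variables and $\mathbb V$ of fixpoint variables. A *game signature* $\mathcal L$ consists of function and relation symbols with arities and of action symbols $\mathfrak a$ with pairs of arities $(k,\ell)$; it contains a $(1,0)$-ary action symbol $*$. The formulas of the first-order modal $\mu$-calculus $\mathrm{FOL}\mu$ over $\mathcal L$ are generated by $$\varphi ::= X \mid \theta_1=\theta_2 \mid R(\theta_1,\dots,\theta_n) \mid \lnot\varphi \mid \varphi_1\land\varphi_2 \mid \langle \mathfrak a_{\bar x}(\bar\theta)\rangle\varphi \mid \mu X.\varphi ,$$ where $X\in\mathbb V$, the $\theta$'s are $\mathcal L$-terms over $\mathcal V$, $\mathfrak a$ is $(k,\ell)$-ary, $\bar x$ is a sequence of $k$ distinct individual variables, $\bar\theta$ a sequence of $\ell$ terms, and in $\mu X.\varphi$ the variable $X$ occurs only positively in $\varphi$. As a logic, $\mathrm{FOL}\mu$ consists of those formulas that have no free fixpoint variables (free individual variables are allowed). Write $\exists x\,\varphi$ for $\langle *_x\rangle\varphi$ and $\langle x:=\theta\rangle\varphi$ for $\exists y(y=\theta\land\exists x(x=y\land\varphi))$ with $y$ fresh;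 the other connectives are the usual abbreviations. **Semantics.** A neighbourhood structure $\mathcal N$ is a first-order structure with non-empty domain $D$ together with, for every $(k,\ell)$-ary $\mathfrak a$, a map $\mathfrak a^{\mathcal N}$ from $D^\ell$ to upward closed families of subsets of $D^k$, where $*^{\mathcal N}(\emptyset)$ is the family of all non-empty subsets of $D$. For an interpretation $\mathcal I:\mathbb V\to\mathcal P(D^{\mathcal V})$ a formula denotes a set of states $\omega:\mathcal V\to D$: atomic formulas and Boolean connectives are as usual, $X$ denotes $\mathcal I(X)$, the formula $\langle \mathfrak a_{\bar x}(\bar\theta)\rangle\varphi$ denotes the set of those $\omega$ for which there is $U\in\mathfrak a^{\mathcal N}(\bar\theta^{\omega})$ with $\omega[\bar x\mapsto\bar u]\in[\![\varphi]\!]_{\mathcal I}$ for all $\bar u\in U$, and $[\![\mu X.\varphi]\!]_{\mathcal I}=\bigcap\{Z:[\![\varphi]\!]_{\mathcal I[X\mapsto Z]}\subseteq Z\}$. **Calculus.** Individual substitution $\varphi[\theta/x]$ is capture-avoiding. For $\theta=x$ it is $\varphi$. Otherwise it acts on atomic formulas as usual and commutes with $\lnot$ and $\land$; $(\mu X.\varphi)[\theta/x]$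 is $\langle x:=\theta\rangle\mu X.\varphi$; and $(\langle \mathfrak a_{\bar y}(\bar\eta)\rangle\varphi)[\theta/x]$ is $\langle \mathfrak a_{\bar y}(\bar\eta[\theta/x])\rangle\varphi$ if $x\in\bar y$, it is $\langle \mathfrak a_{\bar y}(\bar\eta[\theta/x])\rangle(\varphi[\theta/x])$ if $x\notin\bar y$ and no variable of $\bar y$ occurs in $\theta$, and it is $\langle x:=\theta\rangle\langle \mathfrak a_{\bar y}(\bar\eta)\rangle\varphi$ in the remaining case. The set of free individual variables is given by $\mathrm{FV}(\langle \mathfrak a_{\bar x}(\bar\theta)\rangle\varphi)=\mathrm{FV}(\bar\theta)\cup(\mathrm{FV}(\varphi)\setminus\bar x)$, $\mathrm{FV}(\mu X.\varphi)=\mathrm{FV}(\varphi)$, and as usual otherwise. Provability $\vdash$ is generated, over the formulas without free fixpoint variables, by all propositional tautologies, modus ponens, the equality axioms $\theta=\theta$ and $\theta=\eta\to(\varphi[\theta/x]\to\varphi[\eta/x])$, and the following: * $\varphi[\theta/x]\to\exists x\,\varphi$; * from $\psi\to\varphi$ infer $\exists x\,\psi\to\varphi$, if $x\notin\mathrm{FV}(\varphi)$;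 * from $\varphi\to\psi$ infer $\langle \mathfrak a_{\bar x}(\bar\theta)\rangle\varphi\to\langle \mathfrak a_{\bar x}(\bar\theta)\rangle\psi$; * $\psi\land\langle \mathfrak a_{\bar x}(\bar\theta)\rangle\varphi\to\langle \mathfrak a_{\bar x}(\bar\theta)\rangle(\psi\land\varphi)$, if $\mathrm{FV}(\psi)\cap\bar x=\emptyset$; * $\varphi[\mu X.\varphi/X]\to\mu X.\varphi$; * from $\varphi[\psi/X]\to\psi$ infer $\mu X.\varphi\to\psi$. **Theorem ($\mathrm{FOL}\mu$ Variable Hierarchy).** For every game signature $\mathcal L$ and every $\mathrm{FOL}\mu$ formula $\varphi$ over $\mathcal L$ without free fixpoint variables there is an $\mathrm{FOL}\mu$ formula $\psi$ over $\mathcal L$ without free fixpoint variables in which at most two distinct fixpoint variables occur, such that $\vdash\varphi\leftrightarrow\psi$, and such that $\varphi$ and $\psi$ are semantically equivalent, i.e. denote the same set of states in every neighbourhood structure. -/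

import Mathlib

universe u v a w uV uW

namespace FOLmu

/-- A game signature: a first-order signature together with action symbols. A symbol in
`Action k l` is `(k, l)`-ary: it depends on `l` parameters and affects `k` variables.
Every signature contains the quantifier symbol `*`, which is `(1, 0)`-ary. -/
structure GameSignature where
  lang : FirstOrder.Language.{u, v}
  Action : ℕ → ℕ → Type a
  star : Action 1 0

/-- First-order neighbourhood structures with domain `M`: a first-order structure, where moreover
every `(k, l)`-ary action symbol is interpreted by a neighbourhood function, that is, a function
from `M ^ l` to upward closed families of subsets of `M ^ k`. The quantifier symbol is interpreted
by the family of all non-empty subsets. -/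
class NbhdStructure (L : GameSignature.{u, v, a}) (M : Type w) extends L.lang.Structure M where
  actMap : ∀ {k l : ℕ}, L.Action k l → (Fin l → M) → Set (Set (Fin k → M))
  actMap_upward : ∀ {k l : ℕ} (b : L.Action k l) (u : Fin l → M) (S T : Set (Fin k → M)),
    S ∈ actMap b u → S ⊆ T → T ∈ actMap b u
  actMap_star : ∀ u : Fin 0 → M, actMap L.star u = {S | S.Nonempty}

/-- Raw formulas of the first-order `μ`-calculus, with individual variables from `V` and fixpoint
variables from `W`. The `k` variables affected by an action symbol are pairwise distinct. -/
inductive Formula (L : GameSignature.{u, v, a}) (V : Type uV) (W : Type uW) where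
  | fvar (X : W) : Formula L V W
  | eq (s t : L.lang.Term V) : Formula L V W
  | rel {n : ℕ} (R : L.lang.Relations n) (ts : Fin n → L.lang.Term V) : Formula L V W
  | neg (φ : Formula L V W) : Formula L V W
  | and (φ ψ : Formula L V W) : Formula L V W
  | dia {k l : ℕ} (b : L.Action k l) (xs : Fin k ↪ V) (ts : Fin l → L.lang.Term V)
      (φ : Formula L V W) : Formula L V W
  | mu (X : W) (φ : Formula L V W) : Formula L V W

namespace Formula

variable {L : GameSignature.{u, v, a}} {V : Type uV} {W : Type uW}

def imp (φ ψ : Formula L V W) : Formula L V W := neg (and φ (neg ψ))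

def iff (φ ψ : Formula L V W) : Formula L V W := and (imp φ ψ) (imp ψ φ)

/-- `∃ x φ`, an abbreviation for `⟨*_x⟩ φ`. -/
def ex (x : V) (φ : Formula L V W) : Formula L V W :=
  dia L.star ⟨fun _ => x, Function.injective_of_subsingleton _⟩ Fin.elim0 φ

/-! ### Well-formed formulas and sentences -/

/-- `PolIn X true φ`: all free occurrences of the fixpoint variable `X` in `φ` are positive (under
an even number of negations). `PolIn X false φ`: all of them are negative. -/
def PolIn (X : W) : Bool → Formula L V W → Prop
  | p, fvar Y => Y = X → p = true
  | _, eq _ _ => True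
  | _, rel _ _ => True
  | p, neg φ => PolIn X (!p) φ
  | p, and φ ψ => PolIn X p φ ∧ PolIn X p ψ
  | p, dia _ _ _ φ => PolIn X p φ
  | p, mu Y φ => Y = X ∨ PolIn X p φ

/-- In every subformula `μ X. φ`, the variable `X` appears only positively in `φ`. -/
def WellFormed : Formula L V W → Prop
  | fvar _ => True
  | eq _ _ => True
  | rel _ _ => True
  | neg φ => WellFormed φ
  | and φ ψ => WellFormed φ ∧ WellFormed ψ
  | dia _ _ _ φ => WellFormed φ
  | mu X φ => PolIn X true φ ∧ WellFormed φ

/-- The free fixpoint variables. -/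
def freeFix [DecidableEq W] : Formula L V W → Finset W
  | fvar X => {X}
  | eq _ _ => ∅
  | rel _ _ => ∅
  | neg φ => freeFix φ
  | and φ ψ => freeFix φ ∪ freeFix ψ
  | dia _ _ _ φ => freeFix φ
  | mu X φ => (freeFix φ).erase X

/-- All fixpoint variables that occur, free or bound (including in a binder `μ X`). -/
def fixVars [DecidableEq W] : Formula L V W → Finset W
  | fvar X => {X}
  | eq _ _ => ∅
  | rel _ _ => ∅
  | neg φ => fixVars φ
  | and φ ψ => fixVars φ ∪ fixVars ψ
  | dia _ _ _ φ => fixVars φ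
  | mu X φ => insert X (fixVars φ)

/-- The formulas of the first-order `μ`-calculus regarded as a logic: the well-formed formulas
without free fixpoint variables. Free individual variables are allowed. -/
def IsFormula [DecidableEq W] (φ : Formula L V W) : Prop :=
  φ.WellFormed ∧ φ.freeFix = ∅

/-! ### Individual variables and substitution -/

section Substitution

variable [DecidableEq V]

/-- The variables of a tuple of terms. -/
def termsVars {n : ℕ} (ts : Fin n → L.lang.Term V) : Finset V :=
  Finset.univ.biUnion fun i => (ts i).varFinset

/-- The free individual variables. -/
def freeVars : Formula L V W → Finset V
  | fvar _ => ∅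
  | eq s t => s.varFinset ∪ t.varFinset
  | rel _ ts => termsVars ts
  | neg φ => freeVars φ
  | and φ ψ => freeVars φ ∪ freeVars ψ
  | dia _ xs ts φ => termsVars ts ∪ (freeVars φ \ Finset.univ.map xs)
  | mu _ φ => freeVars φ

/-- All individual variables that occur, free or bound. -/
def vars : Formula L V W → Finset V
  | fvar _ => ∅
  | eq s t => s.varFinset ∪ t.varFinset
  | rel _ ts => termsVars ts
  | neg φ => vars φ
  | and φ ψ => vars φ ∪ vars ψ
  | dia _ xs ts φ => termsVars ts ∪ (vars φ ∪ Finset.univ.map xs)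
  | mu _ φ => vars φ

/-- A variable outside a given finite set. -/
noncomputable def fresh [Infinite V] (s : Finset V) : V := (Infinite.exists_notMem_finset s).choose

/-- `⟨x := θ⟩ φ`, an abbreviation for `⟨*_y⟩ (y = θ ∧ ⟨*_x⟩ (x = y ∧ φ))` with `y` fresh. -/
noncomputable def assign [Infinite V] (x : V) (θ : L.lang.Term V) (φ : Formula L V W) :
    Formula L V W :=
  let y := fresh (insert x (θ.varFinset ∪ φ.vars))
  ex y (and (eq (.var y) θ) (ex x (and (eq (.var x) (.var y)) φ)))

/-- Substitution of `θ` for `x` in a term. -/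
def substTerm (x : V) (θ : L.lang.Term V) (t : L.lang.Term V) : L.lang.Term V :=
  t.subst (Function.update FirstOrder.Language.Term.var x θ)

/-- Substitution of a term `θ`, which is not the variable `x`, for `x`. -/
noncomputable def substAux [Infinite V] (x : V) (θ : L.lang.Term V) :
    Formula L V W → Formula L V W
  | fvar X => assign x θ (fvar X)
  | eq s t => eq (substTerm x θ s) (substTerm x θ t)
  | rel R ts => rel R fun i => substTerm x θ (ts i)
  | neg φ => neg (substAux x θ φ)
  | and φ ψ => and (substAux x θ φ) (substAux x θ ψ)
  | dia b ys ts φ =>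
      if x ∈ Finset.univ.map ys then
        dia b ys (fun i => substTerm x θ (ts i)) φ
      else if Disjoint θ.varFinset (Finset.univ.map ys) then
        dia b ys (fun i => substTerm x θ (ts i)) (substAux x θ φ)
      else
        assign x θ (dia b ys ts φ)
  | mu X φ => assign x θ (mu X φ)

open Classical in
/-- Substitution of a term `θ` for the individual variable `x`; by convention, substituting `x`
for itself changes nothing. -/
noncomputable def subst [Infinite V] (x : V) (θ : L.lang.Term V) (φ : Formula L V W) :
    Formula L V W :=
  if θ = .var x then φ else substAux x θ φ

end Substitution

/-- Substitution of a formula `ρ` for the free occurrences of the fixpoint variable `X`. It is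
used only for `ρ` without free fixpoint variables, so that nothing can be captured. -/
def substFix [DecidableEq W] (X : W) (ρ : Formula L V W) : Formula L V W → Formula L V W
  | fvar Y => if X = Y then ρ else fvar Y
  | eq s t => eq s t
  | rel R ts => rel R ts
  | neg φ => neg (substFix X ρ φ)
  | and φ ψ => and (substFix X ρ φ) (substFix X ρ ψ)
  | dia b ys ts φ => dia b ys ts (substFix X ρ φ)
  | mu Y φ => if X = Y then mu Y φ else mu Y (substFix X ρ φ)

/-! ### Semantics -/

/-- The set of states `V → M` that satisfy a formula, for an interpretation `I` of the fixpoint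
variables. Here `Function.extend xs e ω` is the state that agrees with `ω`, except that it maps
`xs i` to `e i`. -/
def sem [DecidableEq W] (M : Type w) [NbhdStructure L M] :
    (W → Set (V → M)) → Formula L V W → Set (V → M)
  | I, fvar X => I X
  | _, eq s t => {ω | s.realize ω = t.realize ω}
  | _, rel R ts => {ω | FirstOrder.Language.Structure.RelMap R fun i => (ts i).realize ω}
  | I, neg φ => (sem M I φ)ᶜ
  | I, and φ ψ => sem M I φ ∩ sem M I ψ
  | I, dia b xs ts φ =>
      {ω | ∃ S ∈ NbhdStructure.actMap b (fun i => (ts i).realize ω),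
        ∀ e ∈ S, Function.extend xs e ω ∈ sem M I φ}
  | I, mu X φ => ⋂₀ {Z | sem M (Function.update I X Z) φ ⊆ Z}

/-- A propositional tautology: true under every valuation of all formulas by truth values that
respects negation and conjunction. -/
def IsTautology (φ : Formula L V W) : Prop :=
  ∀ val : Formula L V W → Prop, (∀ χ, val (neg χ) ↔ ¬ val χ) →
    (∀ χ₁ χ₂, val (and χ₁ χ₂) ↔ val χ₁ ∧ val χ₂) → val φ

end Formula

open Formula

/-! ### The proof calculus -/

/-- Provability in the proof calculus of the first-order `μ`-calculus, on the formulas without free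
fixpoint variables. -/
inductive Provable {L : GameSignature.{u, v, a}} {V : Type uV} {W : Type uW} [DecidableEq V]
    [Infinite V] [DecidableEq W] : Formula L V W → Prop where
  /-- propositional tautologies -/
  | taut {φ : Formula L V W} : φ.IsFormula → φ.IsTautology → Provable φ
  /-- modus ponens -/
  | mp {φ ψ : Formula L V W} : Provable φ → Provable (imp φ ψ) → Provable ψ
  /-- equality: reflexivity -/
  | eqRefl (θ : L.lang.Term V) : Provable (eq θ θ)
  /-- equality: equals may be replaced by equals -/
  | eqSubst (x : V) (θ η : L.lang.Term V) {φ : Formula L V W} : φ.IsFormula →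
      Provable (imp (eq θ η) (imp (subst x θ φ) (subst x η φ)))
  /-- axiom `φ[θ/x] → ∃ x φ` -/
  | exIntro (x : V) (θ : L.lang.Term V) {φ : Formula L V W} : φ.IsFormula →
      Provable (imp (subst x θ φ) (ex x φ))
  /-- rule: from `ψ → φ` infer `∃ x ψ → φ`, if `x` is not free in `φ` -/
  | exElim (x : V) {φ ψ : Formula L V W} : x ∉ φ.freeVars →
      Provable (imp ψ φ) → Provable (imp (ex x ψ) φ)
  /-- monotonicity rule -/
  | mon {k l : ℕ} (b : L.Action k l) (xs : Fin k ↪ V) (ts : Fin l → L.lang.Term V)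
      {φ ψ : Formula L V W} : Provable (imp φ ψ) →
      Provable (imp (dia b xs ts φ) (dia b xs ts ψ))
  /-- context axiom `ψ ∧ ⟨b⟩ φ → ⟨b⟩ (ψ ∧ φ)`, if no variable affected by `b` is free in `ψ` -/
  | context {k l : ℕ} (b : L.Action k l) (xs : Fin k ↪ V) (ts : Fin l → L.lang.Term V)
      {φ ψ : Formula L V W} : φ.IsFormula → ψ.IsFormula →
      Disjoint ψ.freeVars (Finset.univ.map xs) →
      Provable (imp (and ψ (dia b xs ts φ)) (dia b xs ts (and ψ φ)))
  /-- fixpoint axiom `φ[μ X. φ / X] → μ X. φ` -/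
  | fix (X : W) {φ : Formula L V W} : (mu X φ).IsFormula →
      Provable (imp (substFix X (mu X φ) φ) (mu X φ))
  /-- fixpoint induction: from `φ[ψ/X] → ψ` infer `μ X. φ → ψ` -/
  | ind (X : W) {φ ψ : Formula L V W} : (mu X φ).IsFormula → ψ.IsFormula →
      Provable (imp (substFix X ψ φ) ψ) → Provable (imp (mu X φ) ψ)

/-- Semantic equivalence: same denotation in every first-order neighbourhood structure. -/
def SemEquiv {L : GameSignature.{u, v, a}} {V : Type uV} {W : Type uW} [DecidableEq W]
    (φ ψ : Formula L V W) : Prop :=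
  ∀ (M : Type w) [Nonempty M] [NbhdStructure L M] (I : W → Set (V → M)),
    sem M I φ = sem M I ψ

end FOLmu

/-!
Two fixpoint variables suffice because individual variables can serve as memory. If the domain has
at least two elements, then the values of a few fresh individual variables, the flags, can code a
name `X` of a fixpoint variable by a formula `δ X`, where the formulas `δ X` are satisfiable and
pairwise inconsistent. A single fixpoint variable then stands for all the variables in scope: its
restriction to the states with the code `δ X` represents `X`. At a new operator `μ X. φ`, a second
fixpoint variable takes over. It is defined by `φ` in the states with the code `δ X` and copies the
first one in all other states, after which the first one can be bound again. A variable that is in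
scope below an odd number of negations is represented by its complement, so that the variable of the
translation remains positive (`twoVar`, `polIn_twoVar`).

The equivalence is derived in the calculus. For `ρ` that map fixpoint variables to formulas without
free fixpoint variables, the instances of `μ X. φ` are least prefixed points up to provable
equivalence (`Proves.inst_ind`, `Provable.inst_fix`), and instances are monotone in the variables
that occur positively (`Proves.inst_mono`). The correctness of the translation is stated for all
pairs of instances that fit together (`proves_twoVar`). It is proved by induction on the formula,
and at a fixpoint operator each of the two least prefixed points yields a prefixed point for the
other (`proves_mu_iff_mu`).

Under the hypothesis that the domain has one element, there are no codes. But there every formula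
is provably equivalent to its closure under quantifiers, hence a least fixpoint is reached after
a single iteration and no fixpoint operators are needed at all (`proves_oneElement_erase`). The final
formula is a case distinction between the two hypotheses. Semantic equivalence follows from the
soundness of the calculus (`Provable.sound`).
-/

namespace FOLmu

namespace Formula

/-! ### Simultaneous substitution for the fixpoint variables -/

section FixpointVariables

variable {L : GameSignature.{u, v, a}} {V : Type uV} {W : Type uW}

/-- A fixpoint variable that is not free has every polarity. -/
theorem polIn_of_notMem [DecidableEq W] {X : W} {φ : Formula L V W} (h : X ∉ φ.freeFix)
    (p : Bool) : PolIn X p φ := by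
  induction φ generalizing p with
  | fvar Y => simp only [freeFix, Finset.mem_singleton] at h; exact fun e => absurd e.symm h
  | eq | rel => trivial
  | neg φ ih => exact ih h _
  | and φ ψ ih₁ ih₂ =>
    simp only [freeFix, Finset.mem_union, not_or] at h
    exact ⟨ih₁ h.1 _, ih₂ h.2 _⟩
  | dia b xs ts φ ih => exact ih h _
  | mu Y φ ih =>
    by_cases e : Y = X
    · exact Or.inl e
    · refine Or.inr (ih (fun hm => h ?_) _)
      exact Finset.mem_erase.2 ⟨fun h' => e h'.symm, hm⟩

section IsFormula

variable [DecidableEq W] {φ ψ : Formula L V W}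

@[simp] theorem isFormula_neg : (neg φ).IsFormula ↔ φ.IsFormula := Iff.rfl

@[simp] theorem isFormula_and : (and φ ψ).IsFormula ↔ φ.IsFormula ∧ ψ.IsFormula := by
  simp only [IsFormula, WellFormed, freeFix, Finset.union_eq_empty]
  tauto

@[simp] theorem isFormula_imp : (imp φ ψ).IsFormula ↔ φ.IsFormula ∧ ψ.IsFormula := by
  simp [imp]

@[simp] theorem isFormula_iff : (iff φ ψ).IsFormula ↔ φ.IsFormula ∧ ψ.IsFormula := by
  simp only [iff, isFormula_and, isFormula_imp]
  tauto

@[simp] theorem isFormula_dia {k l : ℕ} {b : L.Action k l} {xs : Fin k ↪ V}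
    {ts : Fin l → L.lang.Term V} : (dia b xs ts φ).IsFormula ↔ φ.IsFormula := Iff.rfl

@[simp] theorem isFormula_ex {x : V} : (ex x φ).IsFormula ↔ φ.IsFormula := Iff.rfl

@[simp] theorem isFormula_eq {s t : L.lang.Term V} :
    (eq s t : Formula L V W).IsFormula := ⟨trivial, rfl⟩

@[simp] theorem isFormula_rel {n : ℕ} {R : L.lang.Relations n} {ts : Fin n → L.lang.Term V} :
    (rel R ts : Formula L V W).IsFormula := ⟨trivial, rfl⟩

end IsFormula

/-- Simultaneous substitution of `ρ X` for the free occurrences of each fixpoint variable `X`.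
It is used only for `ρ` that map every variable to itself or to a formula without free fixpoint
variables, so that no fixpoint variable can be captured. -/
def inst [DecidableEq W] : (W → Formula L V W) → Formula L V W → Formula L V W
  | ρ, fvar X => ρ X
  | _, eq s t => eq s t
  | _, rel R ts => rel R ts
  | ρ, neg φ => neg (inst ρ φ)
  | ρ, and φ ψ => and (inst ρ φ) (inst ρ ψ)
  | ρ, dia b xs ts φ => dia b xs ts (inst ρ φ)
  | ρ, mu X φ => mu X (inst (Function.update ρ X (fvar X)) φ)

variable [DecidableEq W]

theorem inst_congr {ρ ρ' : W → Formula L V W} {φ : Formula L V W}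
    (h : ∀ X ∈ φ.freeFix, ρ X = ρ' X) : inst ρ φ = inst ρ' φ := by
  induction φ generalizing ρ ρ' with
  | fvar X => exact h X (by simp [freeFix])
  | eq | rel => rfl
  | neg φ ih => simp only [inst, ih h]
  | and φ ψ ih₁ ih₂ =>
    simp only [freeFix, Finset.mem_union] at h
    simp only [inst, ih₁ fun X hX => h X (Or.inl hX), ih₂ fun X hX => h X (Or.inr hX)]
  | dia b xs ts φ ih => simp only [inst, ih h]
  | mu Y φ ih =>
    simp only [inst]
    rw [ih]
    intro X hX
    by_cases e : X = Y
    · subst e; simp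
    · simp only [Function.update_of_ne e]; exact h X (Finset.mem_erase.2 ⟨e, hX⟩)

theorem inst_fvar (φ : Formula L V W) : inst fvar φ = φ := by
  induction φ with
  | fvar | eq | rel => rfl
  | neg φ ih => simp only [inst, ih]
  | and φ ψ ih₁ ih₂ => simp only [inst, ih₁, ih₂]
  | dia b xs ts φ ih => simp only [inst, ih]
  | mu Y φ ih => simp only [inst, Function.update_eq_self, ih]

theorem inst_of_freeFix_eq_empty {ρ : W → Formula L V W} {φ : Formula L V W}
    (h : φ.freeFix = ∅) : inst ρ φ = φ := by
  rw [inst_congr (ρ' := fvar) (by simp [h]), inst_fvar]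

theorem substFix_eq_inst (X : W) (ψ φ : Formula L V W) :
    substFix X ψ φ = inst (Function.update fvar X ψ) φ := by
  induction φ with
  | fvar Y =>
    by_cases e : X = Y
    · subst e; simp [substFix, inst]
    · simp [substFix, inst, e, Function.update_of_ne (Ne.symm e)]
  | eq | rel => rfl
  | neg φ ih => simp only [substFix, inst, ih]
  | and φ ψ ih₁ ih₂ => simp only [substFix, inst, ih₁, ih₂]
  | dia b xs ts φ ih => simp only [substFix, inst, ih]
  | mu Y φ ih =>
    by_cases e : X = Y
    · subst e; simp [substFix, inst, inst_fvar]
    · rw [substFix, if_neg e, inst, ih, Function.update_comm e, Function.update_eq_self]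

theorem substFix_of_notMem {X : W} {ψ φ : Formula L V W} (h : X ∉ φ.freeFix) :
    substFix X ψ φ = φ := by
  rw [substFix_eq_inst, inst_congr (ρ' := fvar), inst_fvar]
  intro Y hY
  exact Function.update_of_ne (fun e : Y = X => h (e ▸ hY)) _ _

/-- The unfolding of an instance of `μ X. φ` is an instance of `φ`. -/
theorem substFix_inst {X : W} {ψ : Formula L V W} {ρ : W → Formula L V W} (φ : Formula L V W)
    (h : ∀ Y, Y ≠ X → X ∉ (ρ Y).freeFix) :
    substFix X ψ (inst (Function.update ρ X (fvar X)) φ) = inst (Function.update ρ X ψ) φ := by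
  induction φ generalizing ρ with
  | fvar Y =>
    by_cases e : Y = X
    · subst e; simp [inst, substFix]
    · simp only [inst, Function.update_of_ne e]; exact substFix_of_notMem (h Y e)
  | eq | rel => rfl
  | neg φ ih => simp only [substFix, inst, ih h]
  | and φ ψ ih₁ ih₂ => simp only [substFix, inst, ih₁ h, ih₂ h]
  | dia b xs ts φ ih => simp only [substFix, inst, ih h]
  | mu Y φ ih =>
    by_cases e : X = Y
    · subst e; simp [substFix, inst]
    · simp only [inst]
      rw [substFix, if_neg e, Function.update_comm e, Function.update_comm e, ih]
      intro Z hZ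
      by_cases e' : Z = Y
      · subst e'; simpa [freeFix] using e
      · rw [Function.update_of_ne e']; exact h Z hZ

/-- Every fixpoint variable is mapped to itself or to a formula without free fixpoint variables. -/
def Admissible (ρ : W → Formula L V W) : Prop :=
  ∀ X, ρ X = fvar X ∨ (ρ X).IsFormula

theorem Admissible.update {ρ : W → Formula L V W} (h : Admissible ρ) (X : W) :
    Admissible (Function.update ρ X (fvar X)) := by
  intro Y
  by_cases e : Y = X
  · subst e; simp
  · rw [Function.update_of_ne e]; exact h Y

theorem polIn_inst {ρ : W → Formula L V W} (h : Admissible ρ) {X : W} {p : Bool}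
    {φ : Formula L V W} (hφ : PolIn X p φ) : PolIn X p (inst ρ φ) := by
  induction φ generalizing ρ p with
  | fvar Y =>
    rcases h Y with e | e
    · simpa only [inst, e] using hφ
    · exact polIn_of_notMem (by simp [inst, e.2]) _
  | eq | rel => trivial
  | neg φ ih => exact ih h hφ
  | and φ ψ ih₁ ih₂ => exact ⟨ih₁ h hφ.1, ih₂ h hφ.2⟩
  | dia b xs ts φ ih => exact ih h hφ
  | mu Y φ ih => exact hφ.imp id (ih (h.update Y))

theorem wellFormed_inst {ρ : W → Formula L V W} (h : Admissible ρ) {φ : Formula L V W}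
    (hφ : φ.WellFormed) : (inst ρ φ).WellFormed := by
  induction φ generalizing ρ with
  | fvar Y =>
    rcases h Y with e | e
    · simp only [inst, e, WellFormed]
    · exact e.1
  | eq | rel => trivial
  | neg φ ih => exact ih h hφ
  | and φ ψ ih₁ ih₂ => exact ⟨ih₁ h hφ.1, ih₂ h hφ.2⟩
  | dia b xs ts φ ih => exact ih h hφ
  | mu Y φ ih => exact ⟨polIn_inst (h.update Y) hφ.1, ih (h.update Y) hφ.2⟩

theorem exists_of_mem_freeFix_inst {ρ : W → Formula L V W} {Y : W} {φ : Formula L V W}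
    (h : Y ∈ (inst ρ φ).freeFix) : ∃ X ∈ φ.freeFix, Y ∈ (ρ X).freeFix := by
  induction φ generalizing ρ with
  | fvar X => exact ⟨X, by simp [freeFix], h⟩
  | eq | rel => exact absurd h (Finset.notMem_empty _)
  | neg φ ih => exact ih h
  | and φ ψ ih₁ ih₂ =>
    simp only [inst, freeFix, Finset.mem_union] at h ⊢
    rcases h with h | h
    · obtain ⟨X, hX, hY⟩ := ih₁ h; exact ⟨X, Or.inl hX, hY⟩
    · obtain ⟨X, hX, hY⟩ := ih₂ h; exact ⟨X, Or.inr hX, hY⟩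
  | dia b xs ts φ ih => exact ih h
  | mu Z φ ih =>
    simp only [inst, freeFix, Finset.mem_erase] at h ⊢
    obtain ⟨X, hX, hY⟩ := ih h.2
    by_cases e : X = Z
    · subst e; simp [freeFix, h.1] at hY
    · rw [Function.update_of_ne e] at hY; exact ⟨X, ⟨e, hX⟩, hY⟩

theorem isFormula_inst {ρ : W → Formula L V W} (h : ∀ X, (ρ X).IsFormula) {φ : Formula L V W}
    (hφ : φ.WellFormed) : (inst ρ φ).IsFormula := by
  refine ⟨wellFormed_inst (fun X => Or.inr (h X)) hφ, Finset.eq_empty_of_forall_notMem ?_⟩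
  intro Y hY
  obtain ⟨X, -, hX⟩ := exists_of_mem_freeFix_inst hY
  simp [(h X).2] at hX

theorem isFormula_substFix {X : W} {φ ψ : Formula L V W} (hφ : φ.WellFormed)
    (hX : φ.freeFix ⊆ {X}) (hψ : ψ.IsFormula) : (substFix X ψ φ).IsFormula := by
  rw [substFix_eq_inst, inst_congr (ρ' := fun _ => ψ)]
  · exact isFormula_inst (fun _ => hψ) hφ
  · intro Y hY
    rw [Finset.mem_singleton.1 (hX hY), Function.update_self]

theorem freeFix_subset_of_mu {X : W} {φ : Formula L V W} (h : (mu X φ).IsFormula) :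
    φ.freeFix ⊆ {X} := by
  intro Y hY
  by_contra e
  have : Y ∈ (mu X φ).freeFix := Finset.mem_erase.2 ⟨by simpa using e, hY⟩
  simp [h.2] at this

theorem fixVars_inst_subset {ρ : W → Formula L V W} {S : Finset W}
    (h : ∀ X, (ρ X).fixVars ⊆ S) {φ : Formula L V W} (hφ : φ.fixVars ⊆ S) :
    (inst ρ φ).fixVars ⊆ S := by
  induction φ generalizing ρ with
  | fvar X => exact h X
  | eq | rel => simp [inst, fixVars]
  | neg φ ih => exact ih h hφ
  | and φ ψ ih₁ ih₂ =>
    simp only [fixVars, Finset.union_subset_iff] at hφ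
    exact Finset.union_subset (ih₁ h hφ.1) (ih₂ h hφ.2)
  | dia b xs ts φ ih => exact ih h hφ
  | mu Y φ ih =>
    simp only [fixVars, Finset.insert_subset_iff] at hφ
    refine Finset.insert_subset_iff.2 ⟨hφ.1, ih (fun X => ?_) hφ.2⟩
    by_cases e : X = Y
    · subst e; simpa [fixVars] using hφ.1
    · rw [Function.update_of_ne e]; exact h X

end FixpointVariables

/-! ### Free individual variables and substitution for them -/

section IndividualVariables

variable {L : GameSignature.{u, v, a}} {V : Type uV} {W : Type uW} [DecidableEq V]

theorem mem_termsVars {n : ℕ} {ts : Fin n → L.lang.Term V} {x : V} :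
    x ∈ termsVars ts ↔ ∃ i, x ∈ (ts i).varFinset := by
  simp [termsVars]

@[simp] theorem freeVars_imp (φ ψ : Formula L V W) :
    (imp φ ψ).freeVars = φ.freeVars ∪ ψ.freeVars := rfl

@[simp] theorem freeVars_ex (x : V) (φ : Formula L V W) :
    (ex x φ).freeVars = φ.freeVars.erase x := by
  ext y
  simp [ex, freeVars, termsVars, and_comm, eq_comm]

theorem freeVars_subset_vars (φ : Formula L V W) : φ.freeVars ⊆ φ.vars := by
  induction φ with
  | fvar | eq | rel => exact subset_rfl
  | neg φ ih => exact ih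
  | and φ ψ ih₁ ih₂ => exact Finset.union_subset_union ih₁ ih₂
  | dia b xs ts φ ih =>
    exact Finset.union_subset_union subset_rfl
      ((Finset.sdiff_subset.trans ih).trans Finset.subset_union_left)
  | mu X φ ih => exact ih

theorem mem_freeVars_inst [DecidableEq W] {ρ : W → Formula L V W} {x : V} {φ : Formula L V W}
    (h : x ∈ (inst ρ φ).freeVars) : x ∈ φ.freeVars ∨ ∃ X, x ∈ (ρ X).freeVars := by
  induction φ generalizing ρ with
  | fvar X => exact Or.inr ⟨X, h⟩
  | eq | rel => exact Or.inl h
  | neg φ ih => exact ih h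
  | and φ ψ ih₁ ih₂ =>
    simp only [inst, freeVars, Finset.mem_union] at h ⊢
    rcases h with h | h
    · rcases ih₁ h with h | h <;> simp [h]
    · rcases ih₂ h with h | h <;> simp [h]
  | dia b xs ts φ ih =>
    simp only [inst, freeVars, Finset.mem_union, Finset.mem_sdiff] at h ⊢
    rcases h with h | h
    · simp [h]
    · rcases ih h.1 with h' | h'
      · exact Or.inl (Or.inr ⟨h', h.2⟩)
      · exact Or.inr h'
  | mu Y φ ih =>
    rcases ih h with h | ⟨X, hX⟩
    · exact Or.inl h
    · by_cases e : X = Y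
      · subst e; simp [freeVars] at hX
      · rw [Function.update_of_ne e] at hX; exact Or.inr ⟨X, hX⟩

theorem notMem_varFinset_substTerm {x : V} {θ : L.lang.Term V} (h : x ∉ θ.varFinset)
    (t : L.lang.Term V) : x ∉ (substTerm x θ t).varFinset := by
  induction t with
  | var y =>
    by_cases e : y = x
    · subst e; simpa [substTerm, FirstOrder.Language.Term.subst] using h
    · simpa [substTerm, FirstOrder.Language.Term.subst, Function.update_of_ne e,
        FirstOrder.Language.Term.varFinset] using Ne.symm e
  | func f ts ih =>
    simp only [substTerm, FirstOrder.Language.Term.subst, FirstOrder.Language.Term.varFinset,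
      Finset.mem_biUnion, not_exists, not_and, Finset.mem_univ, true_implies] at ih ⊢
    exact ih

theorem fresh_notMem {V : Type uV} [Infinite V] (s : Finset V) : fresh s ∉ s :=
  (Infinite.exists_notMem_finset s).choose_spec

variable [Infinite V]

theorem notMem_freeVars_assign {x : V} {θ : L.lang.Term V} (h : x ∉ θ.varFinset)
    (φ : Formula L V W) : x ∉ (assign x θ φ).freeVars := by
  have hy := fresh_notMem (insert x (θ.varFinset ∪ φ.vars))
  simp only [Finset.mem_insert, not_or] at hy
  simp [assign, freeVars, FirstOrder.Language.Term.varFinset, h, Ne.symm hy.1]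

theorem notMem_freeVars_substAux {x : V} {θ : L.lang.Term V} (h : x ∉ θ.varFinset)
    (φ : Formula L V W) : x ∉ (substAux x θ φ).freeVars := by
  induction φ with
  | fvar | mu => exact notMem_freeVars_assign h _
  | eq s t => simp [substAux, freeVars, notMem_varFinset_substTerm h]
  | rel R ts => simp [substAux, freeVars, mem_termsVars, notMem_varFinset_substTerm h]
  | neg φ ih => exact ih
  | and φ ψ ih₁ ih₂ => simp [substAux, freeVars, ih₁, ih₂]
  | dia b xs ts φ ih =>
    have ht : x ∉ termsVars fun i => substTerm x θ (ts i) := by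
      simp [mem_termsVars, notMem_varFinset_substTerm h]
    rw [substAux]
    split_ifs with h₁ h₂
    · simp only [freeVars, Finset.mem_union, Finset.mem_sdiff, ht, h₁]; simp
    · simp only [freeVars, Finset.mem_union, Finset.mem_sdiff, ht, ih]; simp
    · exact notMem_freeVars_assign h _

theorem isFormula_substAux [DecidableEq W] {x : V} {θ : L.lang.Term V} {φ : Formula L V W}
    (h : φ.IsFormula) : (substAux x θ φ).IsFormula := by
  induction φ with
  | fvar | mu => simpa [substAux, assign] using h
  | eq | rel => simp [substAux]
  | neg φ ih => exact ih h
  | and φ ψ ih₁ ih₂ =>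
    rw [isFormula_and] at h
    exact isFormula_and.2 ⟨ih₁ h.1, ih₂ h.2⟩
  | dia b xs ts φ ih =>
    rw [substAux]
    split_ifs
    · exact h
    · exact ih h
    · simpa [assign] using h

theorem isFormula_subst [DecidableEq W] {x : V} {θ : L.lang.Term V} {φ : Formula L V W}
    (h : φ.IsFormula) : (subst x θ φ).IsFormula := by
  rw [subst]
  split_ifs
  · exact h
  · exact isFormula_substAux h

@[simp] theorem subst_self (x : V) (φ : Formula L V W) : subst x (.var x) φ = φ := if_pos rfl

end IndividualVariables

end Formula

end FOLmu

namespace FOLmu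

namespace Formula

/-! ### Soundness of the calculus -/

section Semantics

variable {L : GameSignature.{u, v, a}} {V : Type uV} {W : Type uW} [DecidableEq W]
  {M : Type w} [NbhdStructure L M]

theorem sem_ex [DecidableEq V] (I : W → Set (V → M)) (x : V) (φ : Formula L V W) :
    sem M I (ex x φ) = {ω | ∃ m, Function.update ω x m ∈ sem M I φ} := by
  have key (ω : V → M) (e : Fin 1 → M) :
      Function.extend (⟨fun _ => x, Function.injective_of_subsingleton _⟩ : Fin 1 ↪ V) e ω =
        Function.update ω x (e 0) := by
    funext y
    by_cases h : y = x
    · subst h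
      rw [Function.update_self]
      exact (Function.injective_of_subsingleton _).extend_apply _ _ 0
    · rw [Function.update_of_ne h, Function.extend_apply']
      rintro ⟨_, h'⟩
      exact h h'.symm
  ext ω
  simp only [ex, sem, NbhdStructure.actMap_star, Set.mem_ofPred_eq, key]
  constructor
  · rintro ⟨S, ⟨e, he⟩, h⟩
    exact ⟨e 0, h e he⟩
  · rintro ⟨m, hm⟩
    exact ⟨{fun _ => m}, Set.singleton_nonempty _, by simpa using hm⟩

theorem mem_sem_imp (I : W → Set (V → M)) (φ ψ : Formula L V W) (ω : V → M) :
    ω ∈ sem M I (imp φ ψ) ↔ (ω ∈ sem M I φ → ω ∈ sem M I ψ) := by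
  simp [imp, sem]

theorem sem_mono {I J : W → Set (V → M)} {φ : Formula L V W} (hφ : φ.WellFormed)
    (h : ∀ X, (I X ⊆ J X ∨ PolIn X false φ) ∧ (J X ⊆ I X ∨ PolIn X true φ)) :
    sem M I φ ⊆ sem M J φ := by
  induction φ generalizing I J with
  | fvar X => exact (h X).1.resolve_right fun h' => by simp [PolIn] at h'
  | eq | rel => exact subset_rfl
  | neg φ ih => exact Set.compl_subset_compl.2 (ih hφ fun X => (h X).symm)
  | and φ ψ ih₁ ih₂ =>
    exact Set.inter_subset_inter
      (ih₁ hφ.1 fun X => ⟨(h X).1.imp id And.left, (h X).2.imp id And.left⟩)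
      (ih₂ hφ.2 fun X => ⟨(h X).1.imp id And.right, (h X).2.imp id And.right⟩)
  | dia b xs ts φ ih =>
    rintro ω ⟨S, hS, hω⟩
    exact ⟨S, hS, fun e he => ih hφ h (hω e he)⟩
  | mu Y φ ih =>
    refine Set.subset_sInter fun Z hZ => Set.sInter_subset_of_mem ?_
    refine (ih hφ.2 fun X => ?_).trans hZ
    by_cases e : X = Y
    · subst e; simp [hφ.1]
    · simp only [Function.update_of_ne e]
      exact ⟨(h X).1.imp id fun h' => h'.resolve_left (Ne.symm e),
        (h X).2.imp id fun h' => h'.resolve_left (Ne.symm e)⟩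

theorem sem_mono_update {X : W} {φ : Formula L V W} (hφ : φ.WellFormed) (hX : PolIn X true φ)
    (I : W → Set (V → M)) {A B : Set (V → M)} (h : A ⊆ B) :
    sem M (Function.update I X A) φ ⊆ sem M (Function.update I X B) φ := by
  refine sem_mono hφ fun Y => ?_
  by_cases e : Y = X
  · subst e; simp [h, hX]
  · simp [Function.update_of_ne e]

theorem sem_mu_prefixed {X : W} {φ : Formula L V W} (hφ : (mu X φ).WellFormed)
    (I : W → Set (V → M)) :
    sem M (Function.update I X (sem M I (mu X φ))) φ ⊆ sem M I (mu X φ) :=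
  Set.subset_sInter fun _ hZ =>
    (sem_mono_update hφ.2 hφ.1 I (Set.sInter_subset_of_mem hZ)).trans hZ

theorem sem_congr {I J : W → Set (V → M)} {φ : Formula L V W}
    (h : ∀ X ∈ φ.freeFix, I X = J X) : sem M I φ = sem M J φ := by
  induction φ generalizing I J with
  | fvar X => exact h X (by simp [freeFix])
  | eq | rel => rfl
  | neg φ ih => simp only [sem, ih h]
  | and φ ψ ih₁ ih₂ =>
    simp only [freeFix, Finset.mem_union] at h
    simp only [sem, ih₁ fun X hX => h X (Or.inl hX), ih₂ fun X hX => h X (Or.inr hX)]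
  | dia b xs ts φ ih => simp only [sem, ih h]
  | mu Y φ ih =>
    simp only [sem]
    have (Z : Set (V → M)) : sem M (Function.update I Y Z) φ = sem M (Function.update J Y Z) φ := by
      refine ih fun X hX => ?_
      by_cases e : X = Y
      · subst e; simp
      · simp only [Function.update_of_ne e]; exact h X (Finset.mem_erase.2 ⟨e, hX⟩)
    simp only [this]

theorem sem_substFix {X : W} {ψ : Formula L V W} (hψ : ψ.freeFix = ∅) (I : W → Set (V → M))
    (φ : Formula L V W) :
    sem M I (substFix X ψ φ) = sem M (Function.update I X (sem M I ψ)) φ := by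
  induction φ generalizing I with
  | fvar Y =>
    by_cases e : X = Y
    · subst e; simp [substFix, sem]
    · simp [substFix, sem, e, Function.update_of_ne (Ne.symm e)]
  | eq | rel => rfl
  | neg φ ih => simp only [substFix, sem, ih]
  | and φ ψ ih₁ ih₂ => simp only [substFix, sem, ih₁, ih₂]
  | dia b xs ts φ ih => simp only [substFix, sem, ih]
  | mu Y φ ih =>
    by_cases e : X = Y
    · subst e; simp [substFix, sem]
    · have (Z : Set (V → M)) : sem M (Function.update I Y Z) ψ = sem M I ψ :=
        sem_congr (by simp [hψ])
      simp only [substFix, if_neg e, sem, ih, this, Function.update_comm e]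

section Coincidence

theorem extend_eq_of_notMem {k : ℕ} (xs : Fin k ↪ V) (e : Fin k → M) (ω : V → M) {x : V}
    (h : x ∉ Finset.univ.map xs) : Function.extend xs e ω x = ω x :=
  Function.extend_apply' _ _ _ (by simpa using h)

variable [DecidableEq V]

/-- Membership in `A` only depends on the values of the variables in `F`. -/
def DeterminedBy (F : Set V) (A : Set (V → M)) : Prop :=
  ∀ ω ω' : V → M, (∀ x ∈ F, ω x = ω' x) → ω ∈ A → ω' ∈ A

theorem realize_congr {t : L.lang.Term V} {ω ω' : V → M}
    (h : ∀ x ∈ t.varFinset, ω x = ω' x) : t.realize ω = t.realize ω' := by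
  induction t with
  | var x => exact h x (by simp [FirstOrder.Language.Term.varFinset])
  | func f ts ih =>
    simp only [FirstOrder.Language.Term.realize]
    congr 1
    funext i
    refine ih i fun x hx => h x ?_
    simp only [FirstOrder.Language.Term.varFinset, Finset.mem_biUnion]
    exact ⟨i, Finset.mem_univ i, hx⟩

theorem extend_congr {k : ℕ} (xs : Fin k ↪ V) (e : Fin k → M) {ω ω' : V → M} {x : V}
    (h : x ∉ Finset.univ.map xs → ω x = ω' x) :
    Function.extend xs e ω x = Function.extend xs e ω' x := by
  by_cases hx : ∃ i, xs i = x
  · obtain ⟨i, rfl⟩ := hx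
    simp only [xs.injective.extend_apply]
  · rw [Function.extend_apply' _ _ _ hx, Function.extend_apply' _ _ _ hx]
    exact h (by simpa using hx)

/-- In the case of a least fixpoint, the states all of whose `F`-variants lie in the fixpoint
form a prefixed point. -/
theorem determinedBy_sem {φ : Formula L V W} (hφ : φ.WellFormed) {F : Set V}
    (hF : ↑φ.freeVars ⊆ F) {I : W → Set (V → M)} (hI : ∀ X ∈ φ.freeFix, DeterminedBy F (I X)) :
    DeterminedBy F (sem M I φ) := by
  induction φ generalizing F I with
  | fvar X => exact hI X (by simp [freeFix])
  | eq s t =>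
    simp only [freeVars, Finset.coe_union, Set.union_subset_iff] at hF
    intro ω ω' h hω
    have hω : s.realize ω = t.realize ω := hω
    rwa [realize_congr fun x hx => h x (hF.1 hx), realize_congr fun x hx => h x (hF.2 hx)] at hω
  | rel R ts =>
    intro ω ω' h hω
    have : (fun i => (ts i).realize ω) = fun i => (ts i).realize ω' := by
      funext i
      exact realize_congr fun x hx => h x (hF (mem_termsVars.2 ⟨i, hx⟩))
    simpa only [sem, Set.mem_ofPred_eq, this] using hω
  | neg φ ih => exact fun ω ω' h hω hω' => hω (ih hφ hF hI ω' ω (fun x hx => (h x hx).symm) hω')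
  | and φ ψ ih₁ ih₂ =>
    simp only [freeVars, Finset.coe_union, Set.union_subset_iff] at hF
    simp only [freeFix, Finset.mem_union] at hI
    exact fun ω ω' h hω => ⟨ih₁ hφ.1 hF.1 (fun X hX => hI X (Or.inl hX)) ω ω' h hω.1,
      ih₂ hφ.2 hF.2 (fun X hX => hI X (Or.inr hX)) ω ω' h hω.2⟩
  | dia b xs ts φ ih =>
    rintro ω ω' h ⟨S, hS, hω⟩
    have : (fun i => (ts i).realize ω) = fun i => (ts i).realize ω' := by
      funext i
      refine realize_congr fun x hx => h x (hF ?_)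
      simp only [freeVars, Finset.coe_union]
      exact Or.inl (mem_termsVars.2 ⟨i, hx⟩)
    rw [this] at hS
    refine ⟨S, hS, fun e he => ?_⟩
    refine ih (F := F ∪ ↑(Finset.univ.map xs)) hφ ?_ ?_ _ _ ?_ (hω e he)
    · intro x hx
      by_cases hxs : x ∈ Finset.univ.map xs
      · exact Or.inr hxs
      · refine Or.inl (hF ?_)
        simp only [freeVars, Finset.coe_union]
        exact Or.inr (Finset.mem_sdiff.2 ⟨hx, hxs⟩)
    · exact fun X hX ω ω' h => hI X hX ω ω' fun x hx => h x (Or.inl hx)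
    · exact fun x hx => extend_congr xs e fun hx' => h x (hx.resolve_right hx')
  | mu Y φ ih =>
    set Z := sem M I (mu Y φ)
    set Z' : Set (V → M) := {ω | ∀ ω', (∀ x ∈ F, ω x = ω' x) → ω' ∈ Z}
    have hZ' : Z' ⊆ Z := fun ω hω => hω ω fun _ _ => rfl
    have hdet : DeterminedBy F Z' := fun ω ω' h hω ω'' h' =>
      hω ω'' fun x hx => (h x hx).trans (h' x hx)
    have hpre : sem M (Function.update I Y Z') φ ⊆ Z' := by
      intro ω hω ω' h
      refine sem_mu_prefixed hφ I (sem_mono_update hφ.2 hφ.1 I hZ' ?_)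
      refine ih hφ.2 hF (fun X hX => ?_) ω ω' h hω
      by_cases e : X = Y
      · subst e; simpa using hdet
      · rw [Function.update_of_ne e]; exact hI X (Finset.mem_erase.2 ⟨e, hX⟩)
    have hle : Z ⊆ Z' := Set.sInter_subset_of_mem hpre
    exact fun ω ω' h hω => hle hω ω' h

theorem mem_sem_congr {φ : Formula L V W} (hφ : φ.IsFormula) (I : W → Set (V → M))
    {ω ω' : V → M} (h : ∀ x ∈ φ.freeVars, ω x = ω' x) : ω ∈ sem M I φ ↔ ω' ∈ sem M I φ := by
  have := determinedBy_sem (M := M) hφ.1 (F := ↑φ.freeVars) subset_rfl (I := I) (by simp [hφ.2])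
  exact ⟨this ω ω' h, this ω' ω fun x hx => (h x hx).symm⟩

theorem realize_substTerm (x : V) (θ t : L.lang.Term V) (ω : V → M) :
    (substTerm x θ t).realize ω = t.realize (Function.update ω x (θ.realize ω)) := by
  rw [substTerm, FirstOrder.Language.Term.realize_subst]
  congr 1
  funext y
  by_cases e : y = x
  · subst e; simp
  · simp [Function.update_of_ne e]

variable [Infinite V]

theorem sem_assign {φ : Formula L V W} (hφ : φ.IsFormula) (x : V) (θ : L.lang.Term V)
    (I : W → Set (V → M)) :
    sem M I (assign x θ φ) = {ω | Function.update ω x (θ.realize ω) ∈ sem M I φ} := by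
  have hy := fresh_notMem (insert x (θ.varFinset ∪ φ.vars))
  simp only [assign]
  generalize fresh (insert x (θ.varFinset ∪ φ.vars)) = y at hy ⊢
  simp only [Finset.mem_insert, Finset.mem_union, not_or] at hy
  obtain ⟨hyx, hyθ, hyφ⟩ := hy
  have hθ (ω : V → M) (m : M) : θ.realize (Function.update ω y m) = θ.realize ω :=
    realize_congr fun z hz => Function.update_of_ne (fun e : z = y => hyθ (e ▸ hz)) _ _
  ext ω
  have hc (m : M) : Function.update (Function.update ω y m) x m ∈ sem M I φ ↔
      Function.update ω x m ∈ sem M I φ := by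
    refine mem_sem_congr hφ I fun z hz => ?_
    have hz' : z ≠ y := fun e => hyφ (e ▸ freeVars_subset_vars φ hz)
    by_cases e : z = x
    · subst e; simp
    · simp [Function.update_of_ne e, Function.update_of_ne hz']
  simp only [sem_ex, sem, Set.mem_ofPred_eq, Set.mem_inter_iff,
    FirstOrder.Language.Term.realize_var, Function.update_self, Function.update_of_ne hyx, hθ]
  constructor
  · rintro ⟨m, rfl, m', rfl, h⟩
    exact (hc _).1 h
  · exact fun h => ⟨_, rfl, _, rfl, (hc _).2 h⟩

theorem sem_substAux {φ : Formula L V W} (hφ : φ.IsFormula) (x : V) (θ : L.lang.Term V)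
    (I : W → Set (V → M)) :
    sem M I (substAux x θ φ) = {ω | Function.update ω x (θ.realize ω) ∈ sem M I φ} := by
  induction φ with
  | fvar | mu => exact sem_assign hφ x θ I
  | eq | rel => simp [substAux, sem, realize_substTerm]
  | neg φ ih => simp only [substAux, sem, ih hφ]; rfl
  | and φ ψ ih₁ ih₂ =>
    rw [isFormula_and] at hφ
    simp only [substAux, sem, ih₁ hφ.1, ih₂ hφ.2]
    rfl
  | dia b ys ts φ ih =>
    rw [substAux]
    split_ifs with h₁ h₂
    · ext ω
      have (e : _) : Function.extend ys e (Function.update ω x (θ.realize ω)) =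
          Function.extend ys e ω := by
        funext z
        refine extend_congr ys e fun hz => Function.update_of_ne ?_ _ _
        rintro rfl
        exact hz h₁
      simp only [sem, Set.mem_ofPred_eq, realize_substTerm, this]
    · ext ω
      have (e : _) : Function.extend ys e (Function.update ω x (θ.realize ω)) =
          Function.update (Function.extend ys e ω) x (θ.realize (Function.extend ys e ω)) := by
        have hθ : θ.realize (Function.extend ys e ω) = θ.realize ω :=
          realize_congr fun z hz => extend_eq_of_notMem ys e ω (Finset.disjoint_left.1 h₂ hz)
        funext z
        by_cases hz : z = x
        · subst hz; rw [extend_eq_of_notMem ys e _ h₁]; simp [hθ]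
        · rw [Function.update_of_ne hz]
          exact extend_congr ys e fun _ => Function.update_of_ne hz _ _
      simp only [sem, Set.mem_ofPred_eq, realize_substTerm, this, ih hφ]
    · exact sem_assign hφ x θ I

theorem sem_subst {φ : Formula L V W} (hφ : φ.IsFormula) (x : V) (θ : L.lang.Term V)
    (I : W → Set (V → M)) :
    sem M I (subst x θ φ) = {ω | Function.update ω x (θ.realize ω) ∈ sem M I φ} := by
  rw [subst]
  split_ifs with h
  · subst h; simp
  · exact sem_substAux hφ x θ I

end Coincidence

end Semantics

end Formula

open Formula

section Soundness

variable {L : GameSignature.{u, v, a}} {V : Type uV} {W : Type uW} [DecidableEq V] [Infinite V]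
  [DecidableEq W]

theorem Provable.isFormula {φ : Formula L V W} (h : Provable φ) : φ.IsFormula := by
  induction h with
  | taut h _ => exact h
  | mp _ _ _ ih => exact (isFormula_imp.1 ih).2
  | eqRefl => simp
  | eqSubst x θ η h => simp [isFormula_subst h]
  | exIntro x θ h => simp [isFormula_subst h, h]
  | exElim x _ _ ih => simpa using ih
  | mon b xs ts _ ih => simpa using ih
  | context b xs ts h₁ h₂ _ => simp [h₁, h₂]
  | fix X h =>
    rw [isFormula_imp]
    exact ⟨isFormula_substFix h.1.2 (freeFix_subset_of_mu h) h, h⟩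
  | ind X h₁ h₂ => simp [h₁, h₂]

theorem Provable.sound {φ : Formula L V W} (h : Provable φ) (M : Type w) [NbhdStructure L M]
    (I : W → Set (V → M)) (ω : V → M) : ω ∈ sem M I φ := by
  induction h generalizing ω with
  | taut _ h => exact h (fun χ => ω ∈ sem M I χ) (fun _ => Iff.rfl) fun _ _ => Iff.rfl
  | mp _ _ ih₁ ih₂ => exact (mem_sem_imp I _ _ ω).1 (ih₂ ω) (ih₁ ω)
  | eqRefl => exact rfl
  | eqSubst x θ η h =>
    simp only [mem_sem_imp, sem_subst h, sem, Set.mem_ofPred_eq]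
    intro e
    simp [e]
  | exIntro x θ h =>
    rw [mem_sem_imp, sem_subst h, sem_ex]
    exact fun h => ⟨_, h⟩
  | exElim x hx hp ih =>
    rw [mem_sem_imp, sem_ex]
    rintro ⟨m, hm⟩
    have := (mem_sem_imp I _ _ _).1 (ih _) hm
    refine (mem_sem_congr (isFormula_imp.1 hp.isFormula).2 I fun y hy => ?_).1 this
    exact Function.update_of_ne (fun e : y = x => hx (e ▸ hy)) _ _
  | mon b xs ts _ ih =>
    rw [mem_sem_imp]
    rintro ⟨S, hS, h⟩
    exact ⟨S, hS, fun e he => (mem_sem_imp I _ _ _).1 (ih _) (h e he)⟩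
  | context b xs ts _ h hd =>
    rw [mem_sem_imp]
    rintro ⟨hψ, S, hS, hφ⟩
    refine ⟨S, hS, fun e he => ⟨(mem_sem_congr h I fun y hy => ?_).1 hψ, hφ e he⟩⟩
    exact (extend_eq_of_notMem xs e ω (Finset.disjoint_left.1 hd hy)).symm
  | fix X h =>
    rw [mem_sem_imp, sem_substFix h.2]
    exact fun hω => sem_mu_prefixed h.1 I hω
  | @ind X φ ψ _ h _ ih =>
    rw [mem_sem_imp]
    refine fun hω => Set.sInter_subset_of_mem (fun ω' hω' => ?_) hω
    exact (mem_sem_imp I _ _ _).1 (ih ω') (by rwa [sem_substFix h.2])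

theorem semEquiv_of_provable_iff {φ ψ : Formula L V W} (h : Provable (iff φ ψ)) :
    SemEquiv.{u, v, a, w, uV, uW} φ ψ := by
  intro M _ _ I
  ext ω
  have := h.sound M I ω
  exact ⟨(mem_sem_imp I _ _ _).1 this.1, (mem_sem_imp I _ _ _).1 this.2⟩

end Soundness

end FOLmu

namespace FOLmu

open Formula

/-! ### Derived rules of the calculus -/

section Calculus

variable {L : GameSignature.{u, v, a}} {V : Type uV} {W : Type uW}

/-- A truth valuation of all formulas that respects negation and conjunction. -/
structure IsTruth (val : Formula L V W → Prop) : Prop where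
  neg : ∀ χ, val (neg χ) ↔ ¬ val χ
  and : ∀ χ₁ χ₂, val (and χ₁ χ₂) ↔ val χ₁ ∧ val χ₂

theorem IsTruth.imp {val : Formula L V W → Prop} (h : IsTruth val) (φ ψ : Formula L V W) :
    val (imp φ ψ) ↔ (val φ → val ψ) := by
  simp only [Formula.imp, h.neg, h.and]
  tauto

theorem IsTruth.iff {val : Formula L V W → Prop} (h : IsTruth val) (φ ψ : Formula L V W) :
    val (iff φ ψ) ↔ (val φ ↔ val ψ) := by
  simp only [Formula.iff, h.imp, h.and]
  tauto

variable {T φ ψ χ χ₁ χ₂ χ₃ : Formula L V W}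

/-- Existential quantification over a list of variables. -/
def exs (l : List V) (φ : Formula L V W) : Formula L V W := l.foldr ex φ

theorem mem_freeVars_exs [DecidableEq V] {l : List V} {x : V} :
    x ∈ (exs l φ).freeVars ↔ x ∈ φ.freeVars ∧ x ∉ l := by
  induction l with
  | nil => simp [exs]
  | cons y l ih =>
    change x ∈ (ex y (exs l φ)).freeVars ↔ _
    simp only [freeVars_ex, Finset.mem_erase, ih, List.mem_cons]
    tauto

variable [DecidableEq W]

@[simp] theorem isFormula_exs {l : List V} : (exs l φ).IsFormula ↔ φ.IsFormula := by
  induction l with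
  | nil => rfl
  | cons x l ih => exact ih

theorem inst_exs (ρ : W → Formula L V W) (l : List V) : inst ρ (exs l φ) = exs l (inst ρ φ) := by
  induction l with
  | nil => rfl
  | cons x l ih => exact congrArg (ex x) ih

theorem isFormula_update {ρ : W → Formula L V W} (h : ∀ X, (ρ X).IsFormula) (X : W)
    (hψ : ψ.IsFormula) (Y : W) : (Function.update ρ X ψ Y).IsFormula := by
  by_cases e : Y = X
  · subst e; simpa using hψ
  · rw [Function.update_of_ne e]; exact h Y

variable [DecidableEq V]

/-- A formula without free fixpoint variables and without free individual variables. -/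
structure IsSentence (T : Formula L V W) : Prop where
  isFormula : T.IsFormula
  freeVars : T.freeVars = ∅

theorem IsSentence.neg (h : IsSentence T) : IsSentence (neg T) := ⟨h.1, h.2⟩

theorem IsSentence.and (hφ : IsSentence φ) (hψ : IsSentence ψ) : IsSentence (and φ ψ) :=
  ⟨by simp [hφ.1, hψ.1], by simp [Formula.freeVars, hφ.2, hψ.2]⟩

variable [Infinite V]

theorem Provable.prop (hφ : φ.IsFormula) (h : ∀ val, IsTruth val → val φ) : Provable φ :=
  .taut hφ fun val hn ha => h val ⟨hn, ha⟩

theorem Provable.prop₁ (h₁ : Provable χ₁) (hφ : φ.IsFormula)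
    (h : ∀ val, IsTruth val → val χ₁ → val φ) : Provable φ :=
  .mp h₁ <| .prop (by simp [h₁.isFormula, hφ]) fun val hv => (hv.imp _ _).2 (h val hv)

theorem Provable.prop₂ (h₁ : Provable χ₁) (h₂ : Provable χ₂) (hφ : φ.IsFormula)
    (h : ∀ val, IsTruth val → val χ₁ → val χ₂ → val φ) : Provable φ :=
  .mp h₂ <| .prop₁ h₁ (by simp [h₂.isFormula, hφ])
    fun val hv hv₁ => (hv.imp _ _).2 (h val hv hv₁)

theorem Provable.prop₃ (h₁ : Provable χ₁) (h₂ : Provable χ₂) (h₃ : Provable χ₃)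
    (hφ : φ.IsFormula) (h : ∀ val, IsTruth val → val χ₁ → val χ₂ → val χ₃ → val φ) :
    Provable φ :=
  .mp h₃ <| .prop₂ h₁ h₂ (by simp [h₃.isFormula, hφ])
    fun val hv hv₁ hv₂ => (hv.imp _ _).2 (h val hv hv₁ hv₂)

/-- Provability from the hypothesis `T`. For a sentence `T`, all the rules of the calculus are
admissible for it, because the context axiom carries `T` past every modality. -/
def Proves (T φ : Formula L V W) : Prop := Provable (imp T φ)

theorem Proves.dia_mono (hT : IsSentence T) {k l : ℕ} (b : L.Action k l) (xs : Fin k ↪ V)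
    (ts : Fin l → L.lang.Term V) (h : Proves T (imp φ ψ)) :
    Proves T (imp (dia b xs ts φ) (dia b xs ts ψ)) := by
  have hf := h.isFormula
  simp only [isFormula_imp] at hf
  have h₁ : Provable (imp (.and T φ) ψ) := by
    refine .prop₁ h (by simp [hf]) fun val hv => ?_
    simp only [hv.imp, hv.and]
    tauto
  refine .prop₂ (.mon b xs ts h₁) (.context b xs ts hf.2.1 hT.1 (by simp [hT.2]))
    (by simp [hf]) fun val hv => ?_
  simp only [hv.imp, hv.and]
  tauto

theorem Proves.ex_mono (hT : IsSentence T) (x : V) (h : Proves T (imp φ ψ)) :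
    Proves T (imp (ex x φ) (ex x ψ)) :=
  h.dia_mono hT _ _ _

theorem Proves.dia_iff (hT : IsSentence T) {k l : ℕ} (b : L.Action k l) (xs : Fin k ↪ V)
    (ts : Fin l → L.lang.Term V) (h : Proves T (iff φ ψ)) :
    Proves T (iff (dia b xs ts φ) (dia b xs ts ψ)) := by
  have hf := h.isFormula
  simp only [isFormula_imp, isFormula_iff] at hf
  have h₁ : Proves T (imp φ ψ) := by
    refine .prop₁ h (by simp [hf]) fun val hv => ?_
    simp only [hv.imp, hv.iff]
    tauto
  have h₂ : Proves T (imp ψ φ) := by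
    refine .prop₁ h (by simp [hf]) fun val hv => ?_
    simp only [hv.imp, hv.iff]
    tauto
  refine .prop₂ (h₁.dia_mono hT b xs ts) (h₂.dia_mono hT b xs ts) (by simp [hf]) fun val hv => ?_
  simp only [hv.imp, hv.iff]
  tauto

theorem Provable.ex_intro (x : V) (h : φ.IsFormula) : Provable (imp φ (ex x φ)) := by
  simpa using Provable.exIntro x (.var x) h

theorem Proves.ex_elim (hT : IsSentence T) {x : V} (hx : x ∉ ψ.freeVars)
    (h : Proves T (imp φ ψ)) : Proves T (imp (ex x φ) ψ) := by
  have hf := h.isFormula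
  simp only [isFormula_imp] at hf
  have h₁ : Provable (imp φ (imp T ψ)) := by
    refine .prop₁ h (by simp [hf]) fun val hv => ?_
    simp only [hv.imp]
    tauto
  refine .prop₁ (.exElim x (by simp [hT.2, hx]) h₁) (by simp [hf]) fun val hv => ?_
  simp only [hv.imp]
  tauto

/-! ### Fixpoint rules for substitution instances -/

theorem Provable.inst_fix {ρ : W → Formula L V W} (h : ∀ X, (ρ X).IsFormula) {X : W}
    (hφ : (mu X φ).WellFormed) :
    Provable (imp (inst (Function.update ρ X (inst ρ (mu X φ))) φ) (inst ρ (mu X φ))) := by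
  have := Provable.fix X (φ := inst (Function.update ρ X (fvar X)) φ) (isFormula_inst h hφ)
  rwa [substFix_inst φ fun Y _ => by simp [(h Y).2]] at this

theorem Provable.inst_ind {ρ : W → Formula L V W} (h : ∀ X, (ρ X).IsFormula) {X : W}
    (hφ : (mu X φ).WellFormed) (hψ : ψ.IsFormula)
    (hp : Provable (imp (inst (Function.update ρ X ψ) φ) ψ)) :
    Provable (imp (inst ρ (mu X φ)) ψ) := by
  refine Provable.ind X (φ := inst (Function.update ρ X (fvar X)) φ) (isFormula_inst h hφ) hψ ?_
  rwa [substFix_inst φ fun Y _ => by simp [(h Y).2]]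

/-- Replacing each fixpoint variable that occurs positively by a weaker formula, and each that
occurs negatively by a stronger one, weakens an instance of `φ`. -/
theorem Proves.inst_mono (hT : IsSentence T) {ρ ρ' : W → Formula L V W}
    (hρ : ∀ X, (ρ X).IsFormula) (hρ' : ∀ X, (ρ' X).IsFormula) (hφ : φ.WellFormed)
    (h : ∀ X, (Proves T (imp (ρ X) (ρ' X)) ∨ PolIn X false φ) ∧
      (Proves T (imp (ρ' X) (ρ X)) ∨ PolIn X true φ)) :
    Proves T (imp (inst ρ φ) (inst ρ' φ)) := by
  have refl (χ : Formula L V W) (hχ : χ.IsFormula) : Proves T (imp χ χ) := by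
    refine .prop (by simp [hχ, hT.1]) fun val hv => ?_
    simp only [hv.imp]
    tauto
  induction φ generalizing ρ ρ' with
  | fvar X => exact (h X).1.resolve_right fun h' => by simp [PolIn] at h'
  | eq | rel => exact refl _ (by simp [inst])
  | neg φ ih =>
    refine .prop₁ (ih hρ' hρ hφ fun X => (h X).symm) ?_ fun val hv => ?_
    · simp [inst, hT.1, isFormula_inst (φ := φ) hρ hφ, isFormula_inst (φ := φ) hρ' hφ]
    · simp only [inst, hv.imp, hv.neg]
      tauto
  | and φ ψ ih₁ ih₂ =>
    refine .prop₂ (ih₁ hρ hρ' hφ.1 fun X => ⟨(h X).1.imp id And.left, (h X).2.imp id And.left⟩)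
      (ih₂ hρ hρ' hφ.2 fun X => ⟨(h X).1.imp id And.right, (h X).2.imp id And.right⟩)
      ?_ fun val hv => ?_
    · simp [inst, hT.1, isFormula_inst hρ hφ.1, isFormula_inst hρ' hφ.1, isFormula_inst hρ hφ.2,
        isFormula_inst hρ' hφ.2]
    · simp only [inst, hv.imp, hv.and]
      tauto
  | dia b xs ts φ ih => exact (ih hρ hρ' hφ h).dia_mono hT b xs ts
  | mu Y φ ih =>
    have hm : (inst ρ' (mu Y φ)).IsFormula := isFormula_inst hρ' hφ
    have hi : (imp T (inst ρ' (mu Y φ))).IsFormula := by simp [hT.1, hm]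
    -- Induction with the invariant `T → μ`, as the rule has no room for the hypothesis `T`.
    have h₁ : Proves T (imp (inst (Function.update ρ Y (imp T (inst ρ' (mu Y φ)))) φ)
        (inst (Function.update ρ' Y (inst ρ' (mu Y φ))) φ)) := by
      refine ih (isFormula_update hρ Y hi) (isFormula_update hρ' Y hm) hφ.2 fun X => ?_
      by_cases e : X = Y
      · subst e
        refine ⟨Or.inl ?_, Or.inr hφ.1⟩
        simp only [Function.update_self]
        refine .prop (by simp [hT.1, hm]) fun val hv => ?_
        simp only [hv.imp]
        tauto
      · simp only [Function.update_of_ne e]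
        exact ⟨(h X).1.imp id fun h' => h'.resolve_left (Ne.symm e),
          (h X).2.imp id fun h' => h'.resolve_left (Ne.symm e)⟩
    have h₂ : Provable (imp (inst ρ (mu Y φ)) (imp T (inst ρ' (mu Y φ)))) := by
      refine .inst_ind hρ hφ hi (.prop₂ h₁ (.inst_fix hρ' hφ) ?_ fun val hv => ?_)
      · simp [hi, isFormula_inst (isFormula_update hρ Y hi) hφ.2]
      · simp only [hv.imp]
        tauto
    refine .prop₁ h₂ ?_ fun val hv => ?_
    · simp [hT.1, hm, isFormula_inst hρ hφ]
    · simp only [hv.imp]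
      tauto

theorem Proves.inst_mono_update (hT : IsSentence T) {ρ : W → Formula L V W}
    (hρ : ∀ X, (ρ X).IsFormula) {X : W} (hφ : φ.WellFormed) (hX : PolIn X true φ)
    (h : Proves T (imp χ ψ)) :
    Proves T (imp (inst (Function.update ρ X χ) φ) (inst (Function.update ρ X ψ) φ)) := by
  have hf := h.isFormula
  simp only [isFormula_imp] at hf
  refine .inst_mono hT (isFormula_update hρ X hf.2.1) (isFormula_update hρ X hf.2.2) hφ fun Y => ?_
  by_cases e : Y = X
  · subst e; simp [h, hX]
  · simp only [Function.update_of_ne e]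
    have : Proves T (imp (ρ Y) (ρ Y)) := by
      refine .prop (by simp [hf.1, hρ]) fun val hv => ?_
      simp only [hv.imp]
      tauto
    exact ⟨Or.inl this, Or.inl this⟩

theorem Proves.inst_ind (hT : IsSentence T) {ρ : W → Formula L V W} (h : ∀ X, (ρ X).IsFormula)
    {X : W} (hφ : (mu X φ).WellFormed) (hψ : ψ.IsFormula)
    (hp : Proves T (imp (inst (Function.update ρ X ψ) φ) ψ)) :
    Proves T (imp (inst ρ (mu X φ)) ψ) := by
  have hi : (imp T ψ).IsFormula := by simp [hT.1, hψ]
  have h₁ : Proves T (imp (imp T ψ) ψ) := by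
    refine .prop (by simp [hi, hT.1, hψ]) fun val hv => ?_
    simp only [hv.imp]
    tauto
  have h₂ : Provable (imp (inst ρ (mu X φ)) (imp T ψ)) := by
    refine .inst_ind h hφ hi (.prop₂ (Proves.inst_mono_update hT h hφ.2 hφ.1 h₁) hp ?_
      fun val hv => ?_)
    · simp [hi, isFormula_inst (isFormula_update h X hi) hφ.2]
    · simp only [hv.imp]
      tauto
  refine .prop₁ h₂ ?_ fun val hv => ?_
  · simp [hT.1, hψ, isFormula_inst h hφ]
  · simp only [hv.imp]
    tauto


theorem Provable.exs_intro (l : List V) (h : φ.IsFormula) : Provable (imp φ (exs l φ)) := by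
  induction l with
  | nil =>
    refine .prop (by simp [h]) fun val hv => ?_
    simp only [hv.imp]
    exact id
  | cons x l ih =>
    change Provable (imp φ (ex x (exs l φ)))
    refine .prop₂ ih (.ex_intro x ((isFormula_exs (l := l)).2 h)) (by simp [h]) fun val hv => ?_
    simp only [hv.imp]
    tauto

theorem Proves.exs_elim (hT : IsSentence T) {l : List V} (hl : ∀ x ∈ l, x ∉ ψ.freeVars)
    (h : Proves T (imp φ ψ)) : Proves T (imp (exs l φ) ψ) := by
  induction l with
  | nil => exact h
  | cons x l ih =>
    rw [List.forall_mem_cons] at hl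
    exact (ih hl.2).ex_elim hT hl.1

end Calculus

end FOLmu

namespace FOLmu

open Formula

/-! ### Domains with one element -/

section OneElement

variable {L : GameSignature.{u, v, a}} {V : Type uV} {W : Type uW}

/-- `∃ g ∀ f (f = g)`: for distinct `f` and `g`, the domain has only one element. -/
def oneElement (f g : V) : Formula L V W := ex g (neg (ex f (neg (eq (.var f) (.var g)))))

/-- A contradictory sentence. -/
def bot (f g : V) : Formula L V W := and (oneElement f g) (neg (oneElement f g))

theorem IsTruth.bot {val : Formula L V W → Prop} (h : IsTruth val) (f g : V) :
    val (bot f g) ↔ False := by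
  simp only [FOLmu.bot, h.and, h.neg]
  tauto

/-- Erases all fixpoint operators and replaces all fixpoint variables by falsity. -/
def Formula.erase (f g : V) : Formula L V W → Formula L V W
  | fvar _ => bot f g
  | eq s t => eq s t
  | rel R ts => rel R ts
  | neg φ => neg (erase f g φ)
  | and φ ψ => and (erase f g φ) (erase f g ψ)
  | dia b xs ts φ => dia b xs ts (erase f g φ)
  | mu _ φ => erase f g φ

theorem fixVars_oneElement [DecidableEq W] (f g : V) :
    (oneElement f g : Formula L V W).fixVars = ∅ := by
  simp [oneElement, ex, fixVars]

theorem fixVars_bot [DecidableEq W] (f g : V) : (bot f g : Formula L V W).fixVars = ∅ := by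
  simp [bot, fixVars, fixVars_oneElement]

theorem fixVars_erase [DecidableEq W] (f g : V) (φ : Formula L V W) :
    (erase f g φ).fixVars = ∅ := by
  induction φ with
  | fvar X => exact fixVars_bot f g
  | eq | rel => rfl
  | neg φ ih => exact ih
  | and φ ψ ih₁ ih₂ => simp [erase, fixVars, ih₁, ih₂]
  | dia b xs ts φ ih => exact ih
  | mu X φ ih => exact ih

variable [DecidableEq V]

theorem isSentence_oneElement [DecidableEq W] (f g : V) :
    IsSentence (oneElement f g : Formula L V W) := by
  refine ⟨by simp [oneElement], ?_⟩
  ext x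
  simp only [oneElement, freeVars, freeVars_ex, Finset.mem_erase, Finset.mem_union,
    FirstOrder.Language.Term.varFinset, Finset.mem_singleton]
  simp
  tauto

theorem isSentence_bot [DecidableEq W] (f g : V) : IsSentence (bot f g : Formula L V W) :=
  (isSentence_oneElement f g).and (isSentence_oneElement f g).neg

theorem isFormula_erase [DecidableEq W] (f g : V) (φ : Formula L V W) :
    (erase f g φ).IsFormula := by
  induction φ with
  | fvar X => exact (isSentence_bot f g).1
  | eq | rel => simp [erase]
  | neg φ ih => exact ih
  | and φ ψ ih₁ ih₂ => simp [erase, ih₁, ih₂]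
  | dia b xs ts φ ih => exact ih
  | mu X φ ih => exact ih

theorem substTerm_self (x : V) (t : L.lang.Term V) : substTerm x (.var x) t = t := by
  rw [substTerm, Function.update_eq_self]
  induction t with
  | var => rfl
  | func f ts ih => simp only [FirstOrder.Language.Term.subst, ih]

@[simp] theorem substTerm_var_self (x : V) (θ : L.lang.Term V) : substTerm x θ (.var x) = θ := by
  simp [substTerm]

theorem substTerm_var_of_ne {x y : V} (h : y ≠ x) (θ : L.lang.Term V) :
    substTerm x θ (.var y) = .var y := by
  simp [substTerm, Function.update_of_ne h]

variable [Infinite V]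

theorem subst_eq (x : V) (θ s t : L.lang.Term V) :
    subst x θ (eq s t : Formula L V W) = eq (substTerm x θ s) (substTerm x θ t) := by
  rw [subst]
  split_ifs with h
  · rw [h, substTerm_self, substTerm_self]
  · rfl

theorem subst_neg (x : V) (θ : L.lang.Term V) (φ : Formula L V W) :
    subst x θ (neg φ) = neg (subst x θ φ) := by
  simp only [subst]
  split_ifs <;> rfl

variable [DecidableEq W] {φ χ : Formula L V W}

theorem Provable.eq_symm (s t : V) :
    Provable (imp (eq (.var s) (.var t)) (eq (.var t) (.var s)) : Formula L V W) := by
  obtain ⟨z, hz⟩ := Infinite.exists_notMem_finset ({s, t} : Finset V)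
  simp only [Finset.mem_insert, Finset.mem_singleton, not_or] at hz
  have h := Provable.eqSubst (W := W) (L := L) z (.var s) (.var t) (φ := eq (.var z) (.var s))
    (by simp)
  simp only [subst_eq, substTerm_var_self, substTerm_var_of_ne (Ne.symm hz.1)] at h
  refine .prop₂ h (.eqRefl (.var s)) (by simp) fun val hv => ?_
  simp only [hv.imp]
  tauto

/-- In a one-element domain a quantifier has no effect. -/
theorem proves_oneElement_ex {f g : V} (hfg : f ≠ g) {x : V} (hx : x ≠ g) (hχ : χ.IsFormula)
    (hg : g ∉ χ.freeVars) : Proves (oneElement f g) (imp (ex x χ) χ) := by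
  set A : Formula L V W := neg (ex f (neg (eq (.var f) (.var g)))) with hA
  have hAf : A.IsFormula := by simp [hA]
  have hxA : x ∉ A.freeVars := by
    simp only [hA, freeVars, freeVars_ex, FirstOrder.Language.Term.varFinset, Finset.mem_erase,
      Finset.mem_union, Finset.mem_singleton]
    tauto
  have hxg : x ∉ (subst x (.var g) χ).freeVars := by
    rw [subst, if_neg (by simpa using Ne.symm hx)]
    exact notMem_freeVars_substAux (by simpa [FirstOrder.Language.Term.varFinset] using hx) χ
  have hs : (subst x (.var g) χ).IsFormula := isFormula_subst hχ
  have h₁ : Provable (imp A (eq (.var x) (.var g))) := by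
    have h := Provable.exIntro (W := W) (L := L) f (.var x) (φ := neg (eq (.var f) (.var g)))
      (by simp)
    simp only [subst_neg, subst_eq, substTerm_var_self, substTerm_var_of_ne (Ne.symm hfg)] at h
    refine .prop₁ h (by simp [hA]) fun val hv => ?_
    simp only [hA, hv.imp, hv.neg]
    tauto
  have h₂ : Provable (imp χ (imp A (subst x (.var g) χ))) := by
    have h := Provable.eqSubst x (.var x) (.var g) hχ
    rw [subst_self] at h
    refine .prop₂ h₁ h (by simp [hχ, hAf, hs]) fun val hv => ?_
    simp only [hv.imp]
    tauto
  have h₃ : Provable (imp A (imp (subst x (.var g) χ) χ)) := by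
    have h := Provable.eqSubst x (.var g) (.var x) hχ
    rw [subst_self] at h
    refine .prop₃ h₁ h (.eq_symm x g) (by simp [hχ, hAf, hs]) fun val hv => ?_
    simp only [hv.imp]
    tauto
  refine .exElim g (by simp [hg]) ?_
  refine .prop₂ (.exElim x (by simp [hxA, hxg]) h₂) h₃ (by simp [hχ]) fun val hv => ?_
  simp only [hv.imp]
  tauto

theorem proves_oneElement_exs {f g : V} (hfg : f ≠ g) {l : List V} (hl : g ∉ l)
    (hχ : χ.IsFormula) (hg : g ∉ χ.freeVars) :
    Proves (oneElement f g) (imp (exs l χ) χ) := by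
  induction l with
  | nil =>
    refine .prop (by simp [exs, hχ, (isSentence_oneElement f g).1]) fun val hv => ?_
    simp only [exs, List.foldr_nil, hv.imp]
    tauto
  | cons x l ih =>
    simp only [List.mem_cons, not_or] at hl
    have h : Proves (oneElement f g) (imp (ex x (exs l χ)) (exs l χ)) :=
      proves_oneElement_ex hfg (Ne.symm hl.1) (by simp [hχ])
        (by simp [mem_freeVars_exs, hg])
    change Proves _ (imp (ex x (exs l χ)) χ)
    refine .prop₂ h (ih hl.2) (by simp [hχ, (isSentence_oneElement f g).1]) fun val hv => ?_
    simp only [hv.imp]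
    tauto

/-- In a one-element domain there is a single state, so a least fixpoint is reached after one
iteration. -/
theorem proves_oneElement_mu {f g : V} (hfg : f ≠ g) {X : W} (hφ : (mu X φ).WellFormed)
    (hg : g ∉ φ.freeVars) :
    Proves (oneElement f g) (iff (inst (fun _ => bot f g) (mu X φ))
      (inst (fun _ => bot f g) φ)) := by
  set E : Formula L V W := oneElement f g
  have hE : IsSentence E := isSentence_oneElement f g
  set ρ : W → Formula L V W := fun _ => bot f g with hρ_def
  have hρ : ∀ X, (ρ X).IsFormula := fun _ => (isSentence_bot f g).1
  set r := inst ρ φ with hr_def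
  have hr : r.IsFormula := isFormula_inst hρ hφ.2
  set m := inst ρ (mu X φ)
  have hm : m.IsFormula := isFormula_inst hρ hφ
  have hupd : Function.update ρ X (bot f g) = ρ := Function.update_eq_self X ρ
  have hgr : g ∉ r.freeVars := by
    intro h
    rcases mem_freeVars_inst h with h | ⟨Y, h⟩
    · exact hg h
    · simp [hρ_def, (isSentence_bot f g).2] at h
  have hrE := proves_oneElement_exs hfg (l := r.freeVars.toList) (by simpa using hgr) hr hgr
  -- `c` states that `r` is false in all states.
  set c : Formula L V W := neg (exs r.freeVars.toList r) with hc_def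
  have hc : IsSentence c := by
    refine ⟨by simp [hc_def, hr], Finset.eq_empty_of_forall_notMem fun x hx => ?_⟩
    simp [hc_def, freeVars, mem_freeVars_exs] at hx
  have hEc : IsSentence (and E c) := hE.and hc
  have h₁ : Proves (and E c) (imp r (bot f g)) := by
    refine .prop₁ (Provable.exs_intro r.freeVars.toList hr)
      (by simp [hE.1, hc.1, hr, (isSentence_bot f g).1]) fun val hv => ?_
    simp only [hc_def, hv.imp, hv.and, hv.neg, hv.bot]
    tauto
  have h₂ : Proves (and E c) (imp (inst (Function.update ρ X r) φ) r) := by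
    have h := Proves.inst_mono_update hEc hρ hφ.2 hφ.1 h₁
    rwa [hupd] at h
  have h₃ : Proves E (imp m r) := by
    refine .inst_ind hE hρ hφ hr (.prop₂ hrE h₂ ?_ fun val hv => ?_)
    · simp [hE.1, hr, isFormula_inst (isFormula_update hρ X hr) hφ.2]
    · simp only [hc_def, hv.imp, hv.and, hv.neg]
      tauto
  have h₄ : Proves E (imp r (inst (Function.update ρ X m) φ)) := by
    have h : Proves E (imp (bot f g) m) := by
      refine .prop (by simp [hE.1, hm, (isSentence_bot f g).1]) fun val hv => ?_
      simp only [hv.imp, hv.bot]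
      tauto
    have h := Proves.inst_mono_update hE hρ hφ.2 hφ.1 h
    rwa [hupd] at h
  refine .prop₃ h₃ h₄ (.inst_fix hρ hφ) (by simp [hE.1, hm, hr]) fun val hv => ?_
  simp only [hv.imp, hv.iff]
  tauto

theorem proves_oneElement_erase {f g : V} (hfg : f ≠ g) (hφ : φ.WellFormed) (hg : g ∉ φ.vars) :
    Proves (oneElement f g) (iff (inst (fun _ => bot f g) φ) (erase f g φ)) := by
  have hE : (oneElement f g : Formula L V W).IsFormula := (isSentence_oneElement f g).1
  have refl (χ : Formula L V W) (hχ : χ.IsFormula) : Proves (oneElement f g) (iff χ χ) := by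
    refine .prop (by simp [hχ, hE]) fun val hv => ?_
    simp only [hv.imp, hv.iff]
    tauto
  induction φ with
  | fvar X => exact refl _ (isSentence_bot f g).1
  | eq s t => exact refl (.eq s t) (by simp)
  | rel R ts => exact refl (.rel R ts) (by simp)
  | neg φ ih =>
    refine .prop₁ (ih hφ hg) (by simpa [inst, erase] using (ih hφ hg).isFormula) fun val hv => ?_
    simp only [inst, erase, hv.imp, hv.iff, hv.neg]
    tauto
  | and φ ψ ih₁ ih₂ =>
    simp only [vars, Finset.mem_union, not_or] at hg
    have h₁ := ih₁ hφ.1 hg.1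
    have h₂ := ih₂ hφ.2 hg.2
    refine .prop₂ h₁ h₂ ?_ fun val hv => ?_
    · have hf₁ := h₁.isFormula
      have hf₂ := h₂.isFormula
      simp only [isFormula_imp, isFormula_iff] at hf₁ hf₂
      simp [inst, erase, hf₁, hf₂]
    · simp only [inst, erase, hv.imp, hv.iff, hv.and]
      tauto
  | dia b xs ts φ ih =>
    simp only [vars, Finset.mem_union, not_or] at hg
    exact (ih hφ hg.2.1).dia_iff (isSentence_oneElement f g) b xs ts
  | mu X φ ih =>
    have h := proves_oneElement_mu hfg hφ fun h => hg (freeVars_subset_vars φ h)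
    have hf := h.isFormula
    simp only [isFormula_imp, isFormula_iff] at hf
    refine .prop₂ h (ih hφ.2 hg) (by simp [hf, isFormula_erase]) fun val hv => ?_
    simp only [erase, hv.imp, hv.iff]
    tauto

end OneElement

end FOLmu

namespace FOLmu

open Formula

/-! ### Codes for fixpoint variables -/

section Code

variable {L : GameSignature.{u, v, a}} {V : Type uV} {W : Type uW}

/-- The `n`-th code: the `n`-th variable of the list `l` equals `g`, while the earlier ones
differ from `g`. For `n` beyond the length of `l`, no variable is required to equal `g`. -/
def code (g : V) : List V → ℕ → Formula L V W
  | [], _ => eq (.var g) (.var g)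
  | x :: _, 0 => eq (.var x) (.var g)
  | x :: l, n + 1 => and (neg (eq (.var x) (.var g))) (code g l n)

theorem IsTruth.not_code_and_code {val : Formula L V W → Prop} (h : IsTruth val) (g : V)
    {l : List V} {m n : ℕ} (hm : m < l.length) (hn : n < l.length) (hmn : m ≠ n) :
    ¬ (val (code g l m) ∧ val (code g l n)) := by
  induction l generalizing m n with
  | nil => simp at hm
  | cons x l ih =>
    match m, n with
    | 0, 0 => exact absurd rfl hmn
    | 0, n + 1 => simp only [code, h.and, h.neg]; tauto
    | m + 1, 0 => simp only [code, h.and, h.neg]; tauto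
    | m + 1, n + 1 =>
      have := ih (m := m) (n := n) (by simpa using hm) (by simpa using hn) (by simpa using hmn)
      simp only [code, h.and, h.neg]
      tauto

theorem fixVars_code [DecidableEq W] (g : V) (l : List V) (n : ℕ) :
    (code g l n : Formula L V W).fixVars = ∅ := by
  induction l generalizing n with
  | nil => rfl
  | cons x l ih => cases n <;> simp [code, fixVars, ih]

theorem isFormula_code [DecidableEq W] (g : V) (l : List V) (n : ℕ) :
    (code g l n : Formula L V W).IsFormula := by
  induction l generalizing n with
  | nil => simp [code]
  | cons x l ih => cases n <;> simp [code, ih]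

variable [DecidableEq V] [Infinite V] [DecidableEq W]

theorem proves_ex_ne {f g x : V} (hfg : f ≠ g) (hxg : x ≠ g) :
    Proves (neg (oneElement f g) : Formula L V W) (ex x (neg (eq (.var x) (.var g)))) := by
  have h₁ := Provable.exIntro (W := W) (L := L) x (.var f) (φ := neg (eq (.var x) (.var g)))
    (by simp)
  simp only [subst_neg, subst_eq, substTerm_var_self, substTerm_var_of_ne (Ne.symm hxg)] at h₁
  have hf : f ∉ (ex x (neg (eq (.var x) (.var g))) : Formula L V W).freeVars := by
    simp only [freeVars, freeVars_ex, FirstOrder.Language.Term.varFinset, Finset.mem_erase,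
      Finset.mem_union, Finset.mem_singleton]
    tauto
  have h₂ := Provable.ex_intro (W := W) (L := L) g
    (φ := neg (ex f (neg (eq (.var f) (.var g))))) (by simp)
  refine .prop₂ (.exElim f hf h₁) h₂ (by simp [oneElement]) fun val hv => ?_
  simp only [oneElement, hv.imp, hv.neg]
  tauto

/-- If there are two elements, the variables of `l` can be given values that have the code `n`. -/
theorem proves_exs_code {f g : V} (hfg : f ≠ g) {l : List V} (hl : l.Nodup) (hg : g ∉ l) (n : ℕ) :
    Proves (neg (oneElement f g) : Formula L V W) (exs l (code g l n)) := by
  have hT : IsSentence (neg (oneElement f g) : Formula L V W) :=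
    (isSentence_oneElement f g).neg
  induction l generalizing n with
  | nil =>
    refine .prop₁ (.eqRefl (.var g)) (by simp [exs, code, hT.1]) fun val hv => ?_
    simp only [exs, code, List.foldr_nil, hv.imp]
    tauto
  | cons x l ih =>
    rw [List.nodup_cons] at hl
    simp only [List.mem_cons, not_or] at hg
    cases n with
    | zero =>
      have h₁ := Provable.exIntro (W := W) (L := L) x (.var g) (φ := eq (.var x) (.var g)) (by simp)
      simp only [subst_eq, substTerm_var_self, substTerm_var_of_ne hg.1] at h₁
      have h₂ : Proves (neg (oneElement f g) : Formula L V W)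
          (imp (eq (.var x) (.var g)) (exs l (eq (.var x) (.var g)))) := by
        refine .prop₁ (Provable.exs_intro l (φ := eq (.var x) (.var g)) (by simp))
          (by simp [hT.1]) fun val hv => ?_
        simp only [hv.imp]
        tauto
      change Proves _ (ex x (exs l (eq (.var x) (.var g))))
      refine .prop₃ h₁ (h₂.ex_mono hT x) (.eqRefl (.var g)) (by simp [hT.1])
        fun val hv => ?_
      simp only [hv.imp]
      tauto
    | succ n =>
      set d : Formula L V W := neg (eq (.var x) (.var g)) with hd
      have hdf : d.IsFormula := by simp [hd]
      have hcf : (code g l n : Formula L V W).IsFormula := isFormula_code g l n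
      change Proves _ (ex x (exs l (and d (code g l n))))
      have h₁ : Proves (neg (oneElement f g))
          (imp (code g l n) (imp d (exs l (and d (code g l n))))) := by
        refine .prop₁ (Provable.exs_intro l (φ := and d (code g l n)) (by simp [hdf, hcf]))
          (by simp [hdf, hcf, hT.1]) fun val hv => ?_
        simp only [hv.imp, hv.and]
        tauto
      have h₂ : Proves (neg (oneElement f g))
          (imp (exs l (code g l n)) (imp d (exs l (and d (code g l n))))) := by
        refine h₁.exs_elim hT fun y hy => ?_
        simp only [freeVars_imp, Finset.mem_union, mem_freeVars_exs, hd, freeVars,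
          FirstOrder.Language.Term.varFinset, Finset.mem_singleton]
        rintro ((rfl | rfl) | h)
        · exact hl.1 hy
        · exact hg.2 hy
        · exact h.2 hy
      have h₃ : Proves (neg (oneElement f g)) (imp d (exs l (and d (code g l n)))) := by
        refine .prop₂ h₂ (ih hl.2 hg.2 n) (by simp [hdf, hcf, hT.1]) fun val hv => ?_
        simp only [hv.imp]
        tauto
      refine .prop₂ (h₃.ex_mono hT x) (proves_ex_ne hfg (Ne.symm hg.1))
        (by simp [hdf, hcf, hT.1]) fun val hv => ?_
      simp only [hv.imp]
      tauto

end Code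

/-! ### The translation into two fixpoint variables -/

section Translation

variable {L : GameSignature.{u, v, a}} {V : Type uV} {W : Type uW}

/-- The formula itself or its negation, according to a sign. -/
def signed : Bool → Formula L V W → Formula L V W
  | true, φ => φ
  | false, φ => neg φ

theorem IsTruth.signed {val : Formula L V W → Prop} (h : IsTruth val) (p : Bool)
    (φ : Formula L V W) : val (signed p φ) ↔ (val φ ↔ p = true) := by
  cases p <;> simp [FOLmu.signed, h.neg]

theorem wellFormed_signed {p : Bool} {φ : Formula L V W} (h : φ.WellFormed) :
    (signed p φ).WellFormed := by
  cases p <;> exact h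

theorem polIn_signed {X : W} {p q : Bool} {φ : Formula L V W} (h : PolIn X (p == q) φ) :
    PolIn X q (signed p φ) := by
  cases p <;> cases q <;> exact h

theorem wellFormed_exs {l : List V} {φ : Formula L V W} : (exs l φ).WellFormed ↔ φ.WellFormed := by
  induction l with
  | nil => rfl
  | cons x l ih => exact ih

theorem polIn_exs {l : List V} {X : W} {p : Bool} {φ : Formula L V W} :
    PolIn X p (exs l φ) ↔ PolIn X p φ := by
  induction l with
  | nil => rfl
  | cons x l ih => exact ih

/-- The signs of the variables in the body of `μ X. φ`, given the signs `σ` outside of it and the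
parity `d` of `μ X. φ`. -/
def bodySign [DecidableEq W] (σ : W → Bool) (d : Bool) (X : W) : W → Bool :=
  Function.update (fun Y => σ Y == d) X true

/-- The translation into formulas with the two fixpoint variables `Z true` and `Z false`.

The current variable `Z b` stands for all fixpoint variables that are in scope: in the states with
the code `δ X` it is `X` if `σ X` is true, and the complement of `X` otherwise. So `X` is translated
by first setting the flags `fs` to the code `δ X`. The signs are there to keep `Z b` positive in the
body of its binder; `d` tells whether the subformula at hand is below an even number of negations
since that binder. A new fixpoint operator `μ X` binds the other variable `Z !b`, which copies
`Z b` in all states without the code `δ X`; afterwards `Z b` is no longer needed, so that it may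
be bound again. -/
def Formula.twoVar [DecidableEq W] (fs : List V) (δ : W → Formula L V W) (Z : Bool → W) :
    (σ : W → Bool) → (d b : Bool) → Formula L V W → Formula L V W
  | σ, _, b, fvar X => signed (σ X) (exs fs (and (δ X) (fvar (Z b))))
  | _, _, _, eq s t => eq s t
  | _, _, _, rel R ts => rel R ts
  | σ, d, b, neg φ => neg (twoVar fs δ Z σ (!d) b φ)
  | σ, d, b, and φ ψ => and (twoVar fs δ Z σ d b φ) (twoVar fs δ Z σ d b ψ)
  | σ, d, b, dia c xs ts φ => dia c xs ts (twoVar fs δ Z σ d b φ)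
  | σ, d, b, mu X φ =>
      exs fs (and (δ X) (mu (Z !b)
        (and (imp (δ X) (twoVar fs δ Z (bodySign σ d X) true (!b) φ))
          (imp (neg (δ X)) (signed d (fvar (Z b)))))))

variable [DecidableEq W] {fs : List V} {δ : W → Formula L V W} {Z : Bool → W}

theorem inst_signed (ρ : W → Formula L V W) (p : Bool) (φ : Formula L V W) :
    inst ρ (signed p φ) = signed p (inst ρ φ) := by
  cases p <;> rfl

@[simp] theorem isFormula_signed {p : Bool} {φ : Formula L V W} :
    (signed p φ).IsFormula ↔ φ.IsFormula := by
  cases p <;> rfl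

theorem freeFix_signed (p : Bool) (φ : Formula L V W) : (signed p φ).freeFix = φ.freeFix := by
  cases p <;> rfl

theorem fixVars_signed (p : Bool) (φ : Formula L V W) : (signed p φ).fixVars = φ.fixVars := by
  cases p <;> rfl

theorem freeFix_exs (l : List V) (φ : Formula L V W) : (exs l φ).freeFix = φ.freeFix := by
  induction l with
  | nil => rfl
  | cons x l ih => exact ih

theorem fixVars_exs (l : List V) (φ : Formula L V W) : (exs l φ).fixVars = φ.fixVars := by
  induction l with
  | nil => rfl
  | cons x l ih => exact ih

theorem fixVars_twoVar (hδ : ∀ X, (δ X).fixVars = ∅) (σ : W → Bool) (d b : Bool)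
    (φ : Formula L V W) : (twoVar fs δ Z σ d b φ).fixVars ⊆ {Z true, Z false} := by
  have hZ (b : Bool) : Z b ∈ ({Z true, Z false} : Finset W) := by cases b <;> simp
  induction φ generalizing σ d b with
  | fvar X => simpa [twoVar, fixVars_signed, fixVars_exs, fixVars, hδ] using hZ b
  | eq | rel => simp [twoVar, fixVars]
  | neg φ ih => exact ih _ _ _
  | and φ ψ ih₁ ih₂ => exact Finset.union_subset (ih₁ _ _ _) (ih₂ _ _ _)
  | dia c xs ts φ ih => exact ih _ _ _
  | mu X φ ih =>
    simp only [twoVar, fixVars_exs, fixVars, fixVars_signed, imp, hδ, Finset.empty_union,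
      Finset.insert_subset_iff, Finset.union_subset_iff, Finset.singleton_subset_iff]
    exact ⟨hZ _, ih _ _ _, hZ _⟩

theorem freeFix_twoVar (hδ : ∀ X, (δ X).IsFormula) (σ : W → Bool) (d b : Bool)
    (φ : Formula L V W) : (twoVar fs δ Z σ d b φ).freeFix ⊆ {Z b} := by
  induction φ generalizing σ d b with
  | fvar X => simp [twoVar, freeFix_signed, freeFix_exs, freeFix, (hδ X).2]
  | eq | rel => simp [twoVar, freeFix]
  | neg φ ih => exact ih _ _ _
  | and φ ψ ih₁ ih₂ => exact Finset.union_subset (ih₁ _ _ _) (ih₂ _ _ _)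
  | dia c xs ts φ ih => exact ih _ _ _
  | mu X φ ih =>
    intro Y hY
    simp only [twoVar, freeFix_exs, freeFix, freeFix_signed, imp, (hδ X).2, Finset.empty_union,
      Finset.mem_erase, Finset.mem_union] at hY
    rcases hY with ⟨hne, hY | hY⟩
    · exact absurd (Finset.mem_singleton.1 (ih _ _ _ hY)) hne
    · exact hY

theorem polIn_bodySign {σ : W → Bool} {d : Bool} {X : W} {φ : Formula L V W}
    (hφ : (mu X φ).WellFormed) (h : ∀ Y, PolIn Y (σ Y == d) (mu X φ)) (Y : W) :
    PolIn Y (bodySign σ d X Y == true) φ := by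
  by_cases e : Y = X
  · subst e; simpa [bodySign] using hφ.1
  · simpa [bodySign, Function.update_of_ne e] using (h Y).resolve_left (Ne.symm e)

theorem polIn_twoVar (hδ : ∀ X, (δ X).IsFormula) (hZ : Function.Injective Z) {σ : W → Bool}
    {d : Bool} (b : Bool) {φ : Formula L V W} (hφ : φ.WellFormed)
    (h : ∀ X, PolIn X (σ X == d) φ) : PolIn (Z b) d (twoVar fs δ Z σ d b φ) := by
  have hδ' (X : W) (p : Bool) : PolIn (Z b) p (δ X) := polIn_of_notMem (by simp [(hδ X).2]) p
  induction φ generalizing σ d with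
  | fvar X => exact polIn_signed (polIn_exs.2 ⟨hδ' X _, fun _ => h X rfl⟩)
  | eq | rel => trivial
  | neg φ ih =>
    refine ih hφ fun X => ?_
    have := h X
    simp only [PolIn] at this
    convert this using 1
    cases σ X <;> cases d <;> rfl
  | and φ ψ ih₁ ih₂ => exact ⟨ih₁ hφ.1 fun X => (h X).1, ih₂ hφ.2 fun X => (h X).2⟩
  | dia c xs ts φ ih => exact ih hφ h
  | mu X φ ih =>
    refine polIn_exs.2 ⟨hδ' X _, Or.inr ⟨⟨hδ' X _, ?_⟩, hδ' X _, ?_⟩⟩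
    · refine polIn_of_notMem (fun hm => ?_) _
      have := hZ (Finset.mem_singleton.1 (freeFix_twoVar hδ _ _ _ _ hm))
      simp at this
    · have : PolIn (Z b) d (signed d (fvar (Z b) : Formula L V W)) :=
        polIn_signed fun _ => by simp
      simpa [PolIn] using this

theorem wellFormed_twoVar (hδ : ∀ X, (δ X).IsFormula) (hZ : Function.Injective Z)
    {σ : W → Bool} {d : Bool} (b : Bool) {φ : Formula L V W} (hφ : φ.WellFormed)
    (h : ∀ X, PolIn X (σ X == d) φ) : (twoVar fs δ Z σ d b φ).WellFormed := by
  induction φ generalizing σ d b with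
  | fvar X => exact wellFormed_signed (wellFormed_exs.2 ⟨(hδ X).1, trivial⟩)
  | eq | rel => trivial
  | neg φ ih =>
    refine ih _ hφ fun X => ?_
    have := h X
    simp only [PolIn] at this
    convert this using 1
    cases σ X <;> cases d <;> rfl
  | and φ ψ ih₁ ih₂ => exact ⟨ih₁ _ hφ.1 fun X => (h X).1, ih₂ _ hφ.2 fun X => (h X).2⟩
  | dia c xs ts φ ih => exact ih _ hφ h
  | mu X φ ih =>
    have hδ' (p : Bool) : PolIn (Z !b) p (δ X) := polIn_of_notMem (by simp [(hδ X).2]) p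
    have hb := polIn_bodySign hφ h
    refine wellFormed_exs.2 ⟨(hδ X).1, ⟨⟨hδ' _, ?_⟩, hδ' _, ?_⟩,
      ⟨(hδ X).1, ih _ hφ.2 hb⟩, (hδ X).1, wellFormed_signed trivial⟩
    · simpa [PolIn] using polIn_twoVar (fs := fs) hδ hZ (!b) hφ.2 hb
    · refine polIn_of_notMem (fun hm => ?_) _
      simp only [freeFix, freeFix_signed, Finset.mem_singleton] at hm
      have := hZ hm
      simp at this

end Translation

end FOLmu

namespace FOLmu

open Formula

/-! ### Correctness of the translation -/

section Correctness

variable {L : GameSignature.{u, v, a}} {V : Type uV} {W : Type uW}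

theorem freeFix_subset_fixVars [DecidableEq W] (φ : Formula L V W) : φ.freeFix ⊆ φ.fixVars := by
  induction φ with
  | fvar | eq | rel => exact subset_rfl
  | neg φ ih => exact ih
  | and φ ψ ih₁ ih₂ => exact Finset.union_subset_union ih₁ ih₂
  | dia b xs ts φ ih => exact ih
  | mu X φ ih => exact (Finset.erase_subset _ _).trans (ih.trans (Finset.subset_insert _ _))

variable [DecidableEq V] [Infinite V] [DecidableEq W] {T : Formula L V W} {fs : List V}
  {δ : W → Formula L V W} {Z : Bool → W}

/-- If `φ` agrees with `ψ` in the states with the code `δ`, and `ψ` does not depend on the flags,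
then `ψ` says that `φ` holds after the flags have been set to the code. -/
theorem Proves.exs_and_iff (hT : IsSentence T) {δ φ ψ : Formula L V W}
    (hδ : Proves T (exs fs δ)) (hψ : ∀ x ∈ fs, x ∉ ψ.freeVars)
    (h : Proves T (imp δ (iff φ ψ))) : Proves T (iff (exs fs (and δ φ)) ψ) := by
  have hf := h.isFormula
  simp only [isFormula_imp, isFormula_iff] at hf
  have h₁ : Proves T (imp (and δ φ) ψ) := by
    refine .prop₁ h (by simp [hf]) fun val hv => ?_
    simp only [hv.imp, hv.iff, hv.and]
    grind
  have h₂ : Proves T (imp δ (imp ψ (exs fs (and δ φ)))) := by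
    refine .prop₂ h (Provable.exs_intro fs (φ := and δ φ) (by simp [hf])) (by simp [hf])
      fun val hv => ?_
    simp only [hv.imp, hv.iff, hv.and]
    grind
  have h₃ : Proves T (imp (exs fs δ) (imp ψ (exs fs (and δ φ)))) :=
    h₂.exs_elim hT fun x hx => by simp [mem_freeVars_exs, hx, hψ x hx]
  refine .prop₃ hδ (h₁.exs_elim hT hψ) h₃ (by simp [hf]) fun val hv => ?_
  simp only [hv.imp, hv.iff]
  grind

/-- The step of the translation at a least fixpoint: `μ Y. body`, whose body is `B` in the states
with the code `δ` and `n` in all others, agrees with `μ X. φ` in the states with the code `δ`.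
Here `B` and `φ` are assumed to agree whenever `Y` codes what `X` stands for. -/
theorem proves_mu_iff_mu (hT : IsSentence T) {δ n B body φ : Formula L V W} {X Y : W}
    {ε ρ : W → Formula L V W} (hδ : δ.IsFormula) (hn : n.IsFormula) (hε : ∀ X, (ε X).IsFormula)
    (hρ : ∀ X, (ρ X).IsFormula) (hB : B.WellFormed) (hBpol : PolIn Y true B)
    (hmu : (mu Y body).WellFormed)
    (hbody : ∀ χ, inst (Function.update ε Y χ) body =
      and (imp δ (inst (Function.update ε Y χ) B)) (imp (neg δ) n))
    (hφ : (mu X φ).WellFormed) (hfs : ∀ x ∈ fs, x ∉ φ.freeVars)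
    (hρf : ∀ X, ∀ x ∈ fs, x ∉ (ρ X).freeVars)
    (key : ∀ r : Formula L V W, r.IsFormula → (∀ x ∈ fs, x ∉ r.freeVars) →
      Proves T (iff (inst (Function.update ε Y (and (imp δ r) (imp (neg δ) n))) B)
        (inst (Function.update ρ X r) φ))) :
    Proves T (imp δ (iff (inst ε (mu Y body)) (inst ρ (mu X φ)))) := by
  set ζ := inst ε (mu Y body)
  have hζ : ζ.IsFormula := isFormula_inst hε hmu
  set π := inst ρ (mu X φ)
  have hπ : π.IsFormula := isFormula_inst hρ hφ
  have hπf : ∀ x ∈ fs, x ∉ π.freeVars := by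
    intro x hx hm
    rcases mem_freeVars_inst hm with hm | ⟨Y, hm⟩
    · exact hfs x hx hm
    · exact hρf Y x hx hm
  have hBf {r : Formula L V W} (hr : r.IsFormula) : (inst (Function.update ε Y r) B).IsFormula :=
    isFormula_inst (isFormula_update hε _ hr) hB
  have hφf {r : Formula L V W} (hr : r.IsFormula) : (inst (Function.update ρ X r) φ).IsFormula :=
    isFormula_inst (isFormula_update hρ _ hr) hφ.2
  -- `π`, extended by `n` to the states without the code `δ`, is a prefixed point of `body`.
  have h₁ : Proves T (imp ζ (and (imp δ π) (imp (neg δ) n))) := by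
    have hκ : (and (imp δ π) (imp (neg δ) n)).IsFormula := by simp [hδ, hπ, hn]
    refine .inst_ind hT hε hmu hκ ?_
    rw [hbody]
    refine .prop₂ (key π hπ hπf) (Provable.inst_fix hρ hφ)
      (by simp [hT.1, hδ, hBf hκ, hπ, hn]) fun val hv => ?_
    simp only [hv.imp, hv.iff, hv.and, hv.neg]
    grind
  -- `r` says that `ζ` holds for all values of the flags with the code `δ`. It is a prefixed point
  -- of `φ`.
  set r : Formula L V W := neg (exs fs (and δ (neg ζ))) with hr_def
  have hr : r.IsFormula := by simp [hr_def, hδ, hζ]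
  have hrf : ∀ x ∈ fs, x ∉ r.freeVars := fun x hx => by
    simp [hr_def, freeVars, mem_freeVars_exs, hx]
  have hrζ : Provable (imp r (imp δ ζ)) := by
    refine .prop₁ (Provable.exs_intro fs (φ := and δ (neg ζ)) (by simp [hδ, hζ]))
      (by simp [hr, hδ, hζ]) fun val hv => ?_
    simp only [hr_def, hv.imp, hv.and, hv.neg]
    grind
  have hfix : Provable (imp (and (imp δ (inst (Function.update ε Y ζ) B)) (imp (neg δ) n)) ζ) := by
    rw [← hbody]
    exact Provable.inst_fix hε hmu
  have h₂ : Proves T (imp (and (imp δ r) (imp (neg δ) n)) ζ) := by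
    refine .prop₂ hrζ hfix (by simp [hT.1, hδ, hr, hn, hζ]) fun val hv => ?_
    simp only [hv.imp, hv.and, hv.neg]
    grind
  have h₃ := Proves.inst_mono_update hT hε hB hBpol h₂
  have h₄ : Proves T (imp (and δ (neg ζ)) (neg (inst (Function.update ρ X r) φ))) := by
    refine .prop₃ (key r hr hrf) h₃ hfix (by simp [hT.1, hδ, hζ, hφf hr]) fun val hv => ?_
    simp only [hv.imp, hv.iff, hv.and, hv.neg]
    grind
  have hφr : ∀ x ∈ fs, x ∉ (inst (Function.update ρ X r) φ).freeVars := by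
    intro x hx hm
    rcases mem_freeVars_inst hm with hm | ⟨Y, hm⟩
    · exact hfs x hx hm
    · by_cases e : Y = X
      · subst e; rw [Function.update_self] at hm; exact hrf x hx hm
      · rw [Function.update_of_ne e] at hm; exact hρf Y x hx hm
  have h₅ : Proves T (imp π r) := by
    refine .inst_ind hT hρ hφ hr ?_
    refine .prop₁ (Proves.exs_elim (ψ := neg _) hT hφr h₄) (by simp [hT.1, hr, hφf hr])
      fun val hv => ?_
    simp only [hr_def, hv.imp, hv.neg]
    grind
  refine .prop₃ h₁ h₅ hrζ (by simp [hT.1, hδ, hζ, hπ]) fun val hv => ?_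
  simp only [hv.imp, hv.iff, hv.and]
  grind

/-- The translation is correct under the hypothesis `T` that all codes are realizable: if the
formula `ε (Z b)` substituted for the current variable agrees with the signed formulas `ρ X`
in the states with the code `δ X`, then the translation of `φ` and `φ` have provably equivalent
instances. -/
theorem proves_twoVar (hT : IsSentence T) (hδ : ∀ X, (δ X).IsFormula)
    (hex : ∀ X, Proves T (exs fs (δ X))) {S : Finset W}
    (hdisj : ∀ X ∈ S, ∀ Y ∈ S, X ≠ Y → ∀ val, IsTruth val → ¬ (val (δ X) ∧ val (δ Y)))
    (hZ : Function.Injective Z) {φ : Formula L V W} (hφ : φ.WellFormed) (hS : φ.fixVars ⊆ S)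
    (hfs : ∀ x ∈ fs, x ∉ φ.vars) {σ : W → Bool} {d : Bool} (b : Bool)
    (hσ : ∀ X, PolIn X (σ X == d) φ) {ε ρ : W → Formula L V W} (hε : ∀ X, (ε X).IsFormula)
    (hρ : ∀ X, (ρ X).IsFormula) (hρf : ∀ X, ∀ x ∈ fs, x ∉ (ρ X).freeVars)
    (h : ∀ X ∈ φ.freeFix, Proves T (imp (δ X) (iff (ε (Z b)) (signed (σ X) (ρ X))))) :
    Proves T (iff (inst ε (twoVar fs δ Z σ d b φ)) (inst ρ φ)) := by
  have refl (χ : Formula L V W) (hχ : χ.IsFormula) : Proves T (iff χ χ) := by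
    refine .prop (by simp [hχ, hT.1]) fun val hv => ?_
    simp only [hv.imp, hv.iff]
    grind
  have hiδ (ρ : W → Formula L V W) (X : W) : inst ρ (δ X) = δ X :=
    inst_of_freeFix_eq_empty (hδ X).2
  induction φ generalizing σ d b ε ρ with
  | fvar X =>
    have hs : ∀ x ∈ fs, x ∉ (signed (σ X) (ρ X)).freeVars := by
      cases σ X <;> exact hρf X
    have h' := Proves.exs_and_iff hT (hex X) hs (h X (by simp [freeFix]))
    have hf := h'.isFormula
    simp only [isFormula_imp, isFormula_iff, isFormula_signed] at hf
    simp only [twoVar, inst_signed, inst_exs, inst, hiδ]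
    refine .prop₁ h' (by simp [hT.1, hρ, hf]) fun val hv => ?_
    simp only [hv.imp, hv.iff, hv.signed]
    grind
  | eq s t => exact refl (.eq s t) (by simp)
  | rel R ts => exact refl (.rel R ts) (by simp)
  | neg φ ih =>
    have h' : Proves T (iff (inst ε (twoVar fs δ Z σ (!d) b φ)) (inst ρ φ)) := by
      refine ih hφ hS hfs b (fun X => ?_) hε hρ hρf h
      have := hσ X
      simp only [PolIn] at this
      convert this using 1
      cases σ X <;> cases d <;> rfl
    have hf := h'.isFormula
    simp only [isFormula_imp, isFormula_iff] at hf
    refine .prop₁ h' (by simp [inst, twoVar, hf]) fun val hv => ?_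
    simp only [inst, twoVar, hv.imp, hv.iff, hv.neg]
    grind
  | and φ ψ ih₁ ih₂ =>
    simp only [fixVars, Finset.union_subset_iff] at hS
    simp only [vars, Finset.mem_union, not_or] at hfs
    simp only [freeFix, Finset.mem_union] at h
    have h₁ := ih₁ hφ.1 hS.1 (fun x hx => (hfs x hx).1) b (fun X => (hσ X).1) hε hρ hρf
      fun X hX => h X (Or.inl hX)
    have h₂ := ih₂ hφ.2 hS.2 (fun x hx => (hfs x hx).2) b (fun X => (hσ X).2) hε hρ hρf
      fun X hX => h X (Or.inr hX)
    have hf₁ := h₁.isFormula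
    have hf₂ := h₂.isFormula
    simp only [isFormula_imp, isFormula_iff] at hf₁ hf₂
    refine .prop₂ h₁ h₂ (by simp [inst, twoVar, hf₁, hf₂]) fun val hv => ?_
    simp only [inst, twoVar, hv.imp, hv.iff, hv.and]
    grind
  | dia c xs ts φ ih =>
    simp only [vars, Finset.mem_union, not_or] at hfs
    exact (ih hφ hS (fun x hx => (hfs x hx).2.1) b hσ hε hρ hρf h).dia_iff hT c xs ts
  | mu X φ ih =>
    simp only [fixVars, Finset.insert_subset_iff] at hS
    have hfs' : ∀ x ∈ fs, x ∉ φ.vars := hfs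
    have hflag' : ∀ x ∈ fs, x ∉ (inst ρ (mu X φ)).freeVars := by
      intro x hx hm
      rcases mem_freeVars_inst hm with hm | ⟨Y, hm⟩
      · exact hfs' x hx (freeVars_subset_vars φ hm)
      · exact hρf Y x hx hm
    have hsign := polIn_bodySign hφ hσ
    have hZb : Z b ≠ Z !b := fun e => by simpa using hZ e
    set B := twoVar fs δ Z (bodySign σ d X) true (!b) φ
    have hBwf : B.WellFormed := wellFormed_twoVar hδ hZ (!b) hφ.2 hsign
    have hBpol : PolIn (Z !b) true B := polIn_twoVar hδ hZ (!b) hφ.2 hsign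
    have hmu : (mu (Z !b) (and (imp (δ X) B)
        (imp (neg (δ X)) (signed d (fvar (Z b)))))).WellFormed := by
      have := wellFormed_twoVar (fs := fs) hδ hZ b hφ hσ
      rw [twoVar, wellFormed_exs] at this
      exact this.2
    have hn : (signed d (ε (Z b))).IsFormula := isFormula_signed.2 (hε _)
    have h₆ := proves_mu_iff_mu hT (hδ X) hn hε hρ hBwf hBpol hmu
      (fun χ => by simp only [inst, imp, hiδ, inst_signed, Function.update_of_ne hZb]) hφ
      (fun x hx hm => hfs' x hx (freeVars_subset_vars φ hm)) hρf fun r hr hrf => by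
        refine ih hφ.2 hS.2 hfs' (!b) hsign (isFormula_update hε _ (by simp [hδ, hr, hn]))
          (isFormula_update hρ X hr) (fun Y => ?_) fun Y hY => ?_
        · by_cases e : Y = X
          · subst e; simpa using hrf
          · rw [Function.update_of_ne e]; exact hρf Y
        rw [Function.update_self]
        by_cases e : Y = X
        · subst e
          simp only [bodySign, Function.update_self]
          refine .prop (by simp [hT.1, hδ, hε, hr]) fun val hv => ?_
          simp only [hv.imp, hv.iff, hv.and, hv.neg, hv.signed]
          grind
        · simp only [bodySign, Function.update_of_ne e]
          have h' := h Y (Finset.mem_erase.2 ⟨e, hY⟩)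
          have hd := hdisj Y (hS.2 (freeFix_subset_fixVars φ hY)) X hS.1 e
          refine .prop₁ h' (by simp [hT.1, hδ, hr, hε, hρ]) fun val hv => ?_
          have hd := hd val hv
          simp only [hv.imp, hv.iff, hv.and, hv.neg, hv.signed]
          cases σ Y <;> cases d <;> simp <;> grind
    have h₇ := Proves.exs_and_iff hT (hex X) hflag' h₆
    rwa [twoVar, inst_exs, inst, hiδ]

/-- The flags and the two auxiliary variables `f`, `g` are chosen fresh. At the top level no
fixpoint variable is in scope, so any formula may be substituted for the current variable of the
translation. -/
theorem exists_two_fixVars [Infinite W] {φ : Formula L V W} (hφ : φ.IsFormula) :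
    ∃ ψ : Formula L V W, ψ.IsFormula ∧ ψ.fixVars.card ≤ 2 ∧ Provable (iff φ ψ) := by
  obtain ⟨f, hf⟩ := Infinite.exists_notMem_finset φ.vars
  obtain ⟨g, hg⟩ := Infinite.exists_notMem_finset (insert f φ.vars)
  simp only [Finset.mem_insert, not_or] at hg
  have hfg : f ≠ g := Ne.symm hg.1
  obtain ⟨F, hFs, hFc⟩ := (Finset.finite_toSet (insert g φ.vars)).infinite_compl
    |>.exists_subset_card_eq φ.fixVars.card
  have hF (x : V) (hx : x ∈ F) : x ≠ g ∧ x ∉ φ.vars := by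
    have := hFs hx
    simpa using this
  set fs := F.toList
  set δ : W → Formula L V W := fun X => code g fs (φ.fixVars.toList.idxOf X) with hδ_def
  have hδ (X : W) : (δ X).IsFormula := isFormula_code _ _ _
  have hδv (X : W) : (δ X).fixVars = ∅ := fixVars_code _ _ _
  obtain ⟨ι, hι⟩ : ∃ ι : Bool → W, Function.Injective ι :=
    ⟨_, (Infinite.natEmbedding W).injective.comp Encodable.encode_injective⟩
  set E : Formula L V W := oneElement f g
  have hE : IsSentence E := isSentence_oneElement f g
  set ρ : W → Formula L V W := fun _ => bot f g with hρ_def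
  have hρ (X : W) : (ρ X).IsFormula := (isSentence_bot f g).1
  have hinst : inst ρ φ = φ := inst_of_freeFix_eq_empty hφ.2
  have hσ (X : W) : PolIn X (true == true) φ := polIn_of_notMem (by simp [hφ.2]) _
  set τ := twoVar fs δ ι (fun _ => true) true true φ
  have hτ : τ.WellFormed := wellFormed_twoVar hδ hι true hφ.1 hσ
  have hτf : (inst ρ τ).IsFormula := isFormula_inst hρ hτ
  have h₁ : Proves E (iff φ (erase f g φ)) := by
    have := proves_oneElement_erase hfg hφ.1 hg.2
    rwa [hinst] at this
  have h₂ : Proves (neg E) (iff (inst ρ τ) φ) := by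
    have := proves_twoVar (T := neg E) (fs := fs) (δ := δ) (S := φ.fixVars) hE.neg hδ
      (fun X => proves_exs_code hfg F.nodup_toList (by simpa [fs] using fun h => (hF g h).1 rfl) _)
      ?_ hι hφ.1 subset_rfl (fun x hx => (hF x (by simpa [fs] using hx)).2) true hσ hρ hρ
      (fun X x _ => by simp [hρ_def, (isSentence_bot f g).2]) (by simp [hφ.2])
    · rwa [hinst] at this
    · intro X hX Y hY hXY val hv
      have hlen {X : W} (hX : X ∈ φ.fixVars) : φ.fixVars.toList.idxOf X < fs.length := by
        rw [Finset.length_toList, hFc, ← Finset.length_toList]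
        exact List.idxOf_lt_length_of_mem (by simpa using hX)
      refine hv.not_code_and_code g (hlen hX) (hlen hY) fun e => hXY ?_
      exact (List.idxOf_inj (by simpa using hX)).1 e
  refine ⟨and (imp E (erase f g φ)) (imp (neg E) (inst ρ τ)), ?_, ?_, ?_⟩
  · simp [hE.1, isFormula_erase, hτf]
  · have h : (inst ρ τ).fixVars ⊆ {ι true, ι false} :=
      fixVars_inst_subset (fun X => by simp [hρ_def, fixVars_bot])
        (fixVars_twoVar hδv _ _ _ _)
    simpa [fixVars, imp, E, fixVars_oneElement, fixVars_erase] using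
      (Finset.card_le_card h).trans Finset.card_le_two
  · refine .prop₂ h₁ h₂ (by simp [hφ, hE.1, isFormula_erase, hτf]) fun val hv => ?_
    simp only [hv.imp, hv.iff, hv.and, hv.neg]
    tauto

end Correctness

end FOLmu

theorem mainTheorem8 (L : FOLmu.GameSignature.{u, v, a}) (V : Type uV) (W : Type uW)
    [DecidableEq V] [Infinite V] [DecidableEq W] [Infinite W]
    (φ : FOLmu.Formula L V W) (hφ : φ.IsFormula) :
    ∃ ψ : FOLmu.Formula L V W, ψ.IsFormula ∧ ψ.fixVars.card ≤ 2 ∧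
      FOLmu.Provable (φ.iff ψ) ∧ FOLmu.SemEquiv.{u, v, a, w, uV, uW} φ ψ := by
  obtain ⟨ψ, hψ, hcard, hp⟩ := FOLmu.exists_two_fixVars hφ
  exact ⟨ψ, hψ, hcard, hp, FOLmu.semEquiv_of_provable_iff hp⟩
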